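/- **Setting.** Let $m:\mathbb R\to[0,\infty)$ be measurable with $\int_{\mathbb R}\frac{m(u)}{u^2+1}\,du<\infty$, and write $\widehat f(u)=\int_{\mathbb R}e^{-iux}f(x)\,dx$. Let $T_m$ be the operator on the complex space $L_2(\mathbb R)$ with $\widehat{T_mf}=\sqrt m\,\widehat f$ and domain $\mathrm{dom}(T_m)=\{f\in L_2(\mathbb R):\int m|\widehat f|^2<\infty\}$. Let $\Omega$ be the dual of the space of real-valued Schwartz functions on $\mathbb R$, with its Borel $\sigma$-algebra, and let $P$ be the white noise measure, i.e. the probability measure on $\Omega$ with $\int_\Omega e^{i\langle\omega,s\rangle}dP(\omega)=e^{-\|s\|_{L_2}^2/2}$ for all real Schwartz functions $s$. Let $f\mapsto Q_f$ be the isometry from $L_2(\mathbb R)$ into the complex space $L_2(\Omega,P)$ that extends $s\mapsto\langle\cdot,s\rangle$ by continuity and complexification. Let $h_0,h_1,\dots$ be the Hermite polynomials $h_j(x)=(-1)^je^{x^2/2}\frac{d^j}{dx^j}e^{-x^2/2}$, let $\widetilde h_k(x)=\pi^{-1/4}((k-1)!)^{-1/2}h_{k-1}(\sqrt2x)e^{-x^2/2}$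 ($k\ge1$) be the Hermite functions, and for a finitely supported multi-index $\alpha=(\alpha_1,\alpha_2,\dots)$ put $H_\alpha(\omega)=\prod_kh_{\alpha_k}(\langle\omega,\widetilde h_k\rangle)$. The Wick product on the Kondratiev space $S_{-1}$ of formal series $\sum_\alpha b_\alpha H_\alpha$ with $\sum_\alpha|b_\alpha|^2\prod_j(2j)^{-q\alpha_j}<\infty$ for some $q\in\mathbb N$ is determined by $H_\alpha\diamond H_\beta=H_{\alpha+\beta}$, that is, $(\sum a_\alpha H_\alpha)\diamond(\sum b_\beta H_\beta)=\sum_\gamma\big(\sum_{\alpha+\beta=\gamma}a_\alpha b_\beta\big)H_\gamma$. Elements of $L_2(\Omega,P)$ are regarded as elements of $S_{-1}$ through their expansions $\sum_\alpha b_\alpha H_\alpha$, convergent in $L_2(\Omega,P)$, and $F^{\diamond n}$ denotes the $n$-th Wick power. **Proposition 6.6.** Let $n\ge1$. (1) Let $f\in\mathrm{dom}(T_m)$. If $T_mf$ is real-valued (a.e.), then $Q_{T_mf}^{\diamond n}$ belongs to $L_2(\Omega,P)$ and $$Q_{T_mf}^{\diamond n}=n!\sum_{k=\lceil n/2\rceil}^{n}\Big(-\frac12\Big)^{n-k}\frac{Q_{T_mf}^{2k-n}}{(2k-n)!}\,\frac{(\|T_mf\|^2)^{n-k}}{(n-k)!}.$$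 For arbitrary, possibly complex-valued $T_mf$, the same holds with $\|T_mf\|^2$ replaced by $\int_{\mathbb R}(T_mf)(x)^2\,dx$. (2) In particular, for every $t\in\mathbb R$ the indicator function $I_t$ of the interval with end points $0$ and $t$ lies in $\mathrm{dom}(T_m)$, and every version $B_m(t)$ of $Q_{T_mI_t}$ (every random variable that is $P$-a.s. equal to it) satisfies, if $m$ is even (a.e.), $$B_m(t)^{\diamond n}=n!\sum_{k=\lceil n/2\rceil}^{n}\Big(-\frac12\Big)^{n-k}\frac{B_m(t)^{2k-n}}{(2k-n)!}\,\frac{(\|T_mI_t\|^2)^{n-k}}{(n-k)!},$$ and for general $m$ the same formula with $\|T_mI_t\|^2$ replaced by $\int_{\mathbb R}(T_mI_t)(x)^2\,dx$. -/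

import Mathlib

open MeasureTheory Filter Topology
open scoped SchwartzMap ENNReal NNReal FourierTransform Nat

noncomputable section

namespace WhiteNoise

/-! ### The operator `T_m` -/

/-- `L²(ℝ)`, complex valued. -/
abbrev L2R : Type := Lp ℂ 2 (volume : Measure ℝ)

/-- Multiplication by `√(m(2πξ))`. -/
def mulSqrt (m : ℝ → ℝ) (g : L2R) (ξ : ℝ) : ℂ := (√(m (2 * Real.pi * ξ)) : ℂ) * g ξ

theorem mulSqrt_add (m : ℝ → ℝ) (f g : L2R) :
    mulSqrt m (f + g) =ᵐ[volume] mulSqrt m f + mulSqrt m g := by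
  filter_upwards [Lp.coeFn_add f g] with ξ hξ
  rw [Pi.add_apply, mulSqrt, mulSqrt, mulSqrt, hξ, Pi.add_apply, mul_add]

theorem mulSqrt_smul (m : ℝ → ℝ) (c : ℂ) (f : L2R) :
    mulSqrt m (c • f) =ᵐ[volume] c • mulSqrt m f := by
  filter_upwards [Lp.coeFn_smul c f] with ξ hξ
  rw [Pi.smul_apply, mulSqrt, mulSqrt, hξ, Pi.smul_apply, smul_eq_mul, smul_eq_mul, mul_left_comm]

/-- The domain of `T_m`: all `f ∈ L²(ℝ)` with `√m f^ ∈ L²(ℝ)`. -/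
def domTm (m : ℝ → ℝ) : Submodule ℂ L2R where
  carrier := {f | MemLp (mulSqrt m (Lp.fourierTransformₗᵢ ℝ ℂ f)) 2 volume}
  zero_mem' := by
    have h : mulSqrt m (Lp.fourierTransformₗᵢ ℝ ℂ 0) =ᵐ[volume] 0 := by
      rw [map_zero]
      filter_upwards [Lp.coeFn_zero ℂ 2 (volume : Measure ℝ)] with ξ hξ
      rw [mulSqrt, hξ, Pi.zero_apply, mul_zero]
    exact (memLp_congr_ae h).2 MemLp.zero
  add_mem' := by
    intro f g hf hg
    rw [Set.mem_ofPred_eq, map_add]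
    exact (memLp_congr_ae (mulSqrt_add m _ _)).2 (MemLp.add hf hg)
  smul_mem' := by
    intro c f hf
    rw [Set.mem_ofPred_eq, map_smul]
    exact (memLp_congr_ae (mulSqrt_smul m c _)).2 (MemLp.const_smul hf c)

theorem memLp_of_mem_domTm {m : ℝ → ℝ} {f : L2R} (hf : f ∈ domTm m) :
    MemLp (mulSqrt m (Lp.fourierTransformₗᵢ ℝ ℂ f)) 2 volume := hf

/-- The (in general unbounded) operator `T_m` on `L²(ℝ)`, defined by
`(T_m f)^(u) = √(m u) * f^(u)` on the domain of all `f ∈ L²(ℝ)` with `∫ m(u) |f^(u)|² du < ∞`,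
where `f^(u) = ∫ e^{-iux} f(x) dx`. Since `f^(u) = (𝓕 f)(u / 2π)` for Mathlib's (unitary)
Fourier transform `𝓕` of `L²(ℝ)`, the substitution `u = 2πξ` turns the defining relation into
`𝓕 (T_m f) ξ = √(m (2πξ)) * 𝓕 f ξ`. The lemmas `mem_domain_Tm` and `hat_Tm` below restate
domain and action in terms of `f^`. -/
def Tm (m : ℝ → ℝ) : L2R →ₗ.[ℂ] L2R where
  domain := domTm m
  toFun :=
    { toFun := fun f => (Lp.fourierTransformₗᵢ ℝ ℂ).symm ((memLp_of_mem_domTm f.2).toLp _)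
      map_add' := by
        intro f g
        rw [← map_add]
        congr 1
        rw [← MemLp.toLp_add]
        refine (MemLp.toLp_eq_toLp_iff _ _).2 ?_
        rw [Submodule.coe_add, map_add]
        exact mulSqrt_add m _ _
      map_smul' := by
        intro c f
        rw [RingHom.id_apply, ← map_smul]
        congr 1
        rw [← MemLp.toLp_const_smul]
        refine (MemLp.toLp_eq_toLp_iff _ _).2 ?_
        rw [Submodule.coe_smul, map_smul]
        exact mulSqrt_smul m c _ }

/-- The Fourier transform `f^(u) = ∫ e^{-iux} f(x) dx` of `f ∈ L²(ℝ)` (an a.e. class). -/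
def hat (f : L2R) (u : ℝ) : ℂ := (𝓕 f : L2R) (u / (2 * Real.pi))

theorem quasi_scale {c : ℝ} (hc : c ≠ 0) :
    Measure.QuasiMeasurePreserving (fun x : ℝ => c * x) volume volume := by
  refine ⟨by fun_prop, ?_⟩
  rw [Real.map_volume_mul_left hc]
  exact Measure.smul_absolutelyContinuous

theorem mem_domain_Tm {m : ℝ → ℝ} (hm : Measurable m) (hm0 : ∀ u, 0 ≤ m u) (f : L2R) :
    f ∈ (Tm m).domain ↔ ∫⁻ u, ENNReal.ofReal (m u * ‖hat f u‖ ^ 2) < ∞ := by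
  have hpi : (2 * Real.pi) ≠ 0 := by positivity
  have hae : AEStronglyMeasurable
      (fun ξ : ℝ => (√(m (2 * Real.pi * ξ)) : ℂ) * (𝓕 f : L2R) ξ) volume := by
    refine AEStronglyMeasurable.mul ?_ (Lp.aestronglyMeasurable _)
    exact (Measurable.aestronglyMeasurable (by fun_prop))
  have h1 : f ∈ (Tm m).domain ↔ ∫⁻ ξ : ℝ, ENNReal.ofReal
      (m (2 * Real.pi * ξ) * ‖hat f (2 * Real.pi * ξ)‖ ^ 2) < ∞ := by
    change MemLp (fun ξ : ℝ => (√(m (2 * Real.pi * ξ)) : ℂ) * (𝓕 f : L2R) ξ) 2 volume ↔ _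
    rw [MemLp, eLpNorm_lt_top_iff_lintegral_rpow_enorm_lt_top (by simp) (by simp)]
    have : ∀ ξ : ℝ, ‖(√(m (2 * Real.pi * ξ)) : ℂ) * (𝓕 f : L2R) ξ‖ₑ ^ (2 : ℝ≥0∞).toReal
        = ENNReal.ofReal (m (2 * Real.pi * ξ) * ‖hat f (2 * Real.pi * ξ)‖ ^ 2) := by
      intro ξ
      have h2 : (2 * Real.pi * ξ) / (2 * Real.pi) = ξ := by field_simp
      rw [hat, h2, ← ofReal_norm, ENNReal.toReal_ofNat]
      rw [ENNReal.ofReal_rpow_of_nonneg (norm_nonneg _) (by norm_num)]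
      congr 1
      rw [norm_mul, Real.rpow_two, mul_pow, Complex.norm_real, Real.norm_eq_abs, sq_abs,
        Real.sq_sqrt (hm0 _)]
    simp only [this]
    exact and_iff_right hae
  rw [h1]
  have h3 : ∫⁻ u, ENNReal.ofReal (m u * ‖hat f u‖ ^ 2)
      ∂(Measure.map (fun x : ℝ => (2 * Real.pi) * x) volume)
      = ∫⁻ ξ : ℝ, ENNReal.ofReal (m (2 * Real.pi * ξ) * ‖hat f (2 * Real.pi * ξ)‖ ^ 2) :=
    (Homeomorph.mulLeft₀ (2 * Real.pi) hpi).measurableEmbedding.lintegral_map _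
  rw [← h3, Real.map_volume_mul_left hpi, lintegral_smul_measure, smul_eq_mul,
    ENNReal.mul_lt_top_iff]
  constructor
  · rintro (h | h | h)
    · exact h.2
    · exact absurd h (by simp)
    · rw [h]; exact ENNReal.zero_lt_top
  · intro h
    exact Or.inl ⟨ENNReal.ofReal_lt_top, h⟩

theorem hat_Tm {m : ℝ → ℝ} (f : (Tm m).domain) :
    ∀ᵐ u, hat (Tm m f) u = (√(m u) : ℂ) * hat f u := by
  have h0 : (𝓕 (Tm m f) : L2R) = (memLp_of_mem_domTm f.2).toLp _ :=
    (Lp.fourierTransformₗᵢ ℝ ℂ).apply_symm_apply _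
  have hpi : (2 * Real.pi)⁻¹ ≠ 0 := by positivity
  have h1 := (memLp_of_mem_domTm f.2).coeFn_toLp
  have h2 := (quasi_scale hpi).ae h1
  filter_upwards [h2] with u hu
  have h3 : u / (2 * Real.pi) = (2 * Real.pi)⁻¹ * u := by ring
  have h4 : 2 * Real.pi * ((2 * Real.pi)⁻¹ * u) = u := by field_simp
  rw [hat, hat, h0, h3, hu, mulSqrt, h4]
  rfl

/-- `I_t`, the indicator function of the interval between `0` and `t`, in `L²(ℝ)`. -/
def intervalL2 (t : ℝ) : L2R :=
  indicatorConstLp 2 (measurableSet_uIcc (a := (0 : ℝ)) (b := t))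
    (isCompact_uIcc.measure_lt_top.ne) (1 : ℂ)

/-! ### The white noise space -/

/-- `Ω`, the dual of the space of real valued Schwartz functions, with its Borel `σ`-algebra. -/
abbrev Omega : Type := WeakDual ℝ 𝓢(ℝ, ℝ)

instance : MeasurableSpace Omega := borel _

instance : BorelSpace Omega := ⟨rfl⟩

/-- `P` is the white noise measure: the probability measure on `Ω` with
`E (exp (i ⟨ω, s⟩)) = exp (- ‖s‖² / 2)` for all real Schwartz functions `s`. -/
class IsWhiteNoise (P : Measure Omega) : Prop where
  isProbabilityMeasure : IsProbabilityMeasure P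
  integral_exp : ∀ s : 𝓢(ℝ, ℝ),
    ∫ ω, Complex.exp (Complex.I * (ω s : ℂ)) ∂P
      = Complex.exp (-((‖s.toLp 2 (volume : Measure ℝ)‖ ^ 2 : ℝ) : ℂ) / 2)

attribute [instance] IsWhiteNoise.isProbabilityMeasure

theorem measurable_eval (s : 𝓢(ℝ, ℝ)) : Measurable (fun ω : Omega => ω s) :=
  (WeakDual.eval_continuous s).measurable

variable (P : Measure Omega) [IsWhiteNoise P]

theorem map_eval (s : 𝓢(ℝ, ℝ)) :
    P.map (fun ω : Omega => ω s)
      = ProbabilityTheory.gaussianReal 0 (‖s.toLp 2 (volume : Measure ℝ)‖₊ ^ 2) := by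
  have := Measure.isProbabilityMeasure_map (μ := P) (measurable_eval s).aemeasurable
  apply Measure.ext_of_charFun
  ext t
  rw [charFun_apply_real, integral_map (measurable_eval s).aemeasurable (by fun_prop),
    ProbabilityTheory.charFun_gaussianReal]
  have h := IsWhiteNoise.integral_exp (P := P) (t • s)
  have h1 : ∀ ω : Omega, Complex.exp (Complex.I * ((ω (t • s) : ℝ) : ℂ))
      = Complex.exp (t * (ω s : ℂ) * Complex.I) := by
    intro ω
    rw [map_smul]
    congr 1
    push_cast [smul_eq_mul]
    ring
  simp only [h1] at h
  rw [h]
  have h2 : (t • s).toLp 2 (volume : Measure ℝ) = t • s.toLp 2 (volume : Measure ℝ) :=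
    map_smul (SchwartzMap.toLpCLM ℝ ℝ 2 (volume : Measure ℝ)) t s
  rw [h2, norm_smul, mul_pow, Real.norm_eq_abs, sq_abs]
  congr 1
  push_cast [coe_nnnorm]
  ring

theorem memLp_eval (s : 𝓢(ℝ, ℝ)) : MemLp (fun ω : Omega => ω s) 2 P := by
  have h := ProbabilityTheory.memLp_id_gaussianReal' (μ := 0)
    (v := ‖s.toLp 2 (volume : Measure ℝ)‖₊ ^ 2) 2 (by simp)
  rw [← map_eval P s] at h
  exact (memLp_map_measure_iff aestronglyMeasurable_id (measurable_eval s).aemeasurable).1 h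

/-- `s ↦ Q_s`, with `Q_s(ω) = ⟨ω, s⟩`, from the real Schwartz functions to `L²(Ω, P)`. -/
def evalLin : 𝓢(ℝ, ℝ) →ₗ[ℝ] Lp ℝ 2 P where
  toFun s := (memLp_eval P s).toLp _
  map_add' s₁ s₂ := by
    rw [← MemLp.toLp_add]
    refine (MemLp.toLp_eq_toLp_iff _ _).2 (Eventually.of_forall fun ω => ?_)
    simp
  map_smul' c s := by
    rw [RingHom.id_apply, ← MemLp.toLp_const_smul]
    refine (MemLp.toLp_eq_toLp_iff _ _).2 (Eventually.of_forall fun ω => ?_)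
    simp

/-- The isometry `f ↦ Q_f` of real `L²` spaces, extended by continuity from the
Schwartz functions, which are dense in `L²(ℝ)`. -/
def QReal : Lp ℝ 2 (volume : Measure ℝ) →L[ℝ] Lp ℝ 2 P :=
  (evalLin P).extendOfNorm (SchwartzMap.toLpCLM ℝ ℝ 2 (volume : Measure ℝ)).toLinearMap

theorem norm_evalLin (s : 𝓢(ℝ, ℝ)) :
    ‖evalLin P s‖ = ‖s.toLp 2 (volume : Measure ℝ)‖ := by
  have h1 : ∫ ω, (ω s) ^ 2 ∂P = ‖s.toLp 2 (volume : Measure ℝ)‖ ^ 2 := by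
    have h2 : ∫ ω, (ω s) ^ 2 ∂P
        = ∫ x, x ^ 2 ∂(ProbabilityTheory.gaussianReal 0
          (‖s.toLp 2 (volume : Measure ℝ)‖₊ ^ 2)) := by
      rw [← map_eval P s, integral_map (measurable_eval s).aemeasurable (by fun_prop)]
    rw [h2]
    have h3 := ProbabilityTheory.variance_fun_id_gaussianReal (μ := 0)
      (v := ‖s.toLp 2 (volume : Measure ℝ)‖₊ ^ 2)
    rw [ProbabilityTheory.variance_of_integral_eq_zero (by fun_prop) (by simp)] at h3
    rw [h3]
    simp
  have h4 : ‖evalLin P s‖ ^ 2 = ∫ ω, (ω s) ^ 2 ∂P := by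
    rw [← real_inner_self_eq_norm_sq, L2.inner_def]
    refine integral_congr_ae ?_
    filter_upwards [(memLp_eval P s).coeFn_toLp] with ω hω
    change inner ℝ ((memLp_eval P s).toLp _ ω) ((memLp_eval P s).toLp _ ω) = _
    rw [hω]
    simp [sq]
  exact (sq_eq_sq₀ (norm_nonneg _) (norm_nonneg _)).1 (h4.trans h1)

theorem QReal_toLp (s : 𝓢(ℝ, ℝ)) :
    QReal P (s.toLp 2 (volume : Measure ℝ)) = evalLin P s :=
  LinearMap.extendOfNorm_eq (e := (SchwartzMap.toLpCLM ℝ ℝ 2 (volume : Measure ℝ)).toLinearMap)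
    (SchwartzMap.denseRange_toLpCLM ENNReal.ofNat_ne_top)
    ⟨1, fun s => by rw [one_mul]; exact (norm_evalLin P s).le⟩ s

/-- `Q_f` for complex valued `f ∈ L²(ℝ)`, by complexification: `Q_{u + iv} = Q_u + i Q_v`. -/
def Q (f : L2R) : Lp ℂ 2 P :=
  Complex.ofRealCLM.compLp (QReal P (Complex.reCLM.compLp f))
    + Complex.I • Complex.ofRealCLM.compLp (QReal P (Complex.imCLM.compLp f))

/-! ### Hermite functions and the chaos basis -/

theorem gaussian_decay (p : Polynomial ℝ) :
    ∃ C : ℝ, ∀ x : ℝ, |p.eval x| * Real.exp (-(x ^ 2 / 2)) ≤ C := by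
  refine ⟨∑ i ∈ p.support, |p.coeff i| * (i ! * Real.exp (1 / 2)), fun x => ?_⟩
  rw [Polynomial.eval_eq_sum, Polynomial.sum]
  refine (mul_le_mul_of_nonneg_right (Finset.abs_sum_le_sum_abs _ _) (Real.exp_pos _).le).trans ?_
  rw [Finset.sum_mul]
  refine Finset.sum_le_sum fun i _ => ?_
  rw [abs_mul, mul_assoc]
  refine mul_le_mul_of_nonneg_left ?_ (abs_nonneg _)
  rw [abs_pow]
  have h1 : |x| ^ i / i ! ≤ Real.exp |x| := Real.pow_div_factorial_le_exp _ (abs_nonneg x) i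
  have h2 : |x| ^ i ≤ i ! * Real.exp |x| := by
    rw [div_le_iff₀ (by positivity)] at h1
    linarith
  refine (mul_le_mul_of_nonneg_right h2 (Real.exp_pos _).le).trans ?_
  rw [mul_assoc, ← Real.exp_add]
  refine mul_le_mul_of_nonneg_left (Real.exp_le_exp.2 ?_) (by positivity)
  nlinarith [sq_nonneg (|x| - 1), sq_abs x]

/-- `exp (-x²/2)` as a Schwartz function. -/
def gaussianSchwartz : 𝓢(ℝ, ℝ) where
  toFun x := Real.exp (-(x ^ 2 / 2))
  smooth' := by fun_prop
  decay' := by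
    intro k n
    obtain ⟨C, hC⟩ := gaussian_decay
      (Polynomial.X ^ k * (Polynomial.hermite n).map (Int.castRingHom ℝ))
    refine ⟨C, fun x => ?_⟩
    refine le_trans (le_of_eq ?_) (hC x)
    rw [norm_iteratedFDeriv_eq_norm_iteratedDeriv, iteratedDeriv_eq_iterate,
      Polynomial.deriv_gaussian_eq_hermite_mul_gaussian]
    simp only [Polynomial.eval_mul, Polynomial.eval_pow, Polynomial.eval_X, norm_mul, norm_pow,
      norm_neg, norm_one, one_pow, one_mul, abs_mul, abs_pow, Real.norm_eq_abs, Real.abs_exp]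
    rw [Polynomial.eval_map, Polynomial.aeval_def]
    simp only [mul_assoc]
    rfl

theorem hasTemperateGrowth_hermite (j : ℕ) :
    Function.HasTemperateGrowth (fun x : ℝ =>
      Polynomial.aeval (√2 * x) (Polynomial.hermite j) / (Real.pi ^ (1 / 4 : ℝ) * √(j !))) := by
  simp only [Polynomial.aeval_eq_sum_range, div_eq_mul_inv, zsmul_eq_mul]
  refine Function.HasTemperateGrowth.mul ?_ (by fun_prop)
  refine Function.HasTemperateGrowth.sum fun i _ => ?_
  fun_prop

/-- The Hermite functions, numbered from `0`: `hermiteFun j` is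
`x ↦ h_j(√2 x) exp (-x²/2) / (π^{1/4} √(j!))` with the probabilists' Hermite polynomial `h_j`,
as a Schwartz function. -/
def hermiteFun (j : ℕ) : 𝓢(ℝ, ℝ) :=
  SchwartzMap.smulLeftCLM ℝ (fun x : ℝ =>
    Polynomial.aeval (√2 * x) (Polynomial.hermite j) / (Real.pi ^ (1 / 4 : ℝ) * √(j !)))
    gaussianSchwartz

theorem hermiteFun_apply (j : ℕ) (x : ℝ) :
    hermiteFun j x = Polynomial.aeval (√2 * x) (Polynomial.hermite j)
      * Real.exp (-(x ^ 2 / 2)) / (Real.pi ^ (1 / 4 : ℝ) * √(j !)) := by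
  rw [hermiteFun, SchwartzMap.smulLeftCLM_apply_apply (hasTemperateGrowth_hermite j), smul_eq_mul,
    div_mul_eq_mul_div]
  rfl

/-- Finitely supported multi-indices `α`. -/
abbrev MultiIndex : Type := ℕ →₀ ℕ

/-- `H_α(ω) = ∏_k h_{α_k}(⟨ω, hermiteFun k⟩)`; the factors with `α_k = 0` are `1`. -/
def chaosH (α : MultiIndex) (ω : Omega) : ℝ :=
  α.prod fun k j => Polynomial.aeval (ω (hermiteFun k)) (Polynomial.hermite j)

/-- `F ∈ L²(Ω, P)` and `F = ∑_α a_α H_α` with (unconditional) convergence in `L²(Ω, P)`. -/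
def HasChaosExpansion (P : Measure Omega) (a : MultiIndex → ℂ) (F : Omega → ℂ) : Prop :=
  MemLp F 2 P ∧
    Tendsto (fun s : Finset MultiIndex =>
      eLpNorm (fun ω => F ω - ∑ α ∈ s, a α * (chaosH α ω : ℂ)) 2 P) atTop (𝓝 0)

/-! ### The Kondratiev space `S₋₁` and the Wick product -/

/-- `(2ℕ)^α = ∏_j (2j)^{α_j}` for indices `j = 1, 2, …` (shifted by one here). -/
def twoNPow (α : MultiIndex) : ℝ := α.prod fun j k => (2 * ((j : ℝ) + 1)) ^ k

/-- The growth condition on the coefficients of an element `∑ b_α H_α` of `S₋₁`. -/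
def IsKondratiev (b : MultiIndex → ℂ) : Prop :=
  ∃ q : ℕ, 1 ≤ q ∧ Summable fun α => ‖b α‖ ^ 2 * (twoNPow α ^ q)⁻¹

/-- The Kondratiev space `S₋₁` of stochastic distributions: formal series `∑ b_α H_α` with
`∑ |b_α|² (2ℕ)^{-qα} < ∞` for some `q`. -/
def Kondratiev : Type := {b : MultiIndex → ℂ // IsKondratiev b}

/-- The coefficients of the Wick product, determined by `H_α ⋄ H_β = H_{α+β}`. -/
def wickCoeff (a b : MultiIndex → ℂ) (γ : MultiIndex) : ℂ :=
  ∑ x ∈ Finset.HasAntidiagonal.antidiagonal γ, a x.1 * b x.2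

theorem twoNPow_add (α β : MultiIndex) : twoNPow (α + β) = twoNPow α * twoNPow β :=
  Finsupp.prod_add_index' (fun _ => pow_zero _) (fun _ _ _ => pow_add _ _ _)

theorem one_le_twoNPow (α : MultiIndex) : 1 ≤ twoNPow α := by
  refine Finset.one_le_prod fun j _ => ?_
  have : (1 : ℝ) ≤ 2 * ((j : ℝ) + 1) := by
    have := Nat.cast_nonneg (α := ℝ) j
    linarith
  exact one_le_pow₀ this

theorem card_antidiagonal_le (γ : MultiIndex) :
    ((Finset.HasAntidiagonal.antidiagonal γ).card : ℝ) ≤ twoNPow γ := by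
  have h1 : (Finset.HasAntidiagonal.antidiagonal γ).card ≤ (Finset.Iic γ).card := by
    refine Finset.card_le_card_of_injOn Prod.fst ?_ ?_
    · intro x hx
      have hx' : x.1 + x.2 = γ := by simpa using hx
      simp only [Finset.coe_Iic, Set.mem_Iic, ← hx']
      exact le_self_add
    · intro x hx y hy hxy
      have hx' : x.1 + x.2 = γ := by simpa using hx
      have hy' : y.1 + y.2 = γ := by simpa using hy
      refine Prod.ext hxy ?_
      rw [← hy', hxy] at hx'
      exact add_left_cancel hx'
  refine (Nat.cast_le.2 h1).trans ?_
  rw [Finsupp.card_Iic, twoNPow, Finsupp.prod]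
  push_cast
  refine Finset.prod_le_prod (fun _ _ => by positivity) fun j _ => ?_
  rw [Nat.card_Iic]
  have h2 : (1 : ℝ) + (γ j : ℝ) * 1 ≤ (1 + 1) ^ (γ j) := one_add_mul_le_pow (by norm_num) _
  have h3 : ((1 : ℝ) + 1) ^ (γ j) ≤ (2 * ((j : ℝ) + 1)) ^ (γ j) := by
    refine pow_le_pow_left₀ (by norm_num) ?_ _
    have := Nat.cast_nonneg (α := ℝ) j
    linarith
  push_cast
  linarith

theorem IsKondratiev.of_le {b : MultiIndex → ℂ} {q r : ℕ} (hqr : q ≤ r)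
    (h : Summable fun α => ‖b α‖ ^ 2 * (twoNPow α ^ q)⁻¹) :
    Summable fun α => ‖b α‖ ^ 2 * (twoNPow α ^ r)⁻¹ := by
  refine Summable.of_nonneg_of_le (fun α => ?_) (fun α => ?_) h
  · have := one_le_twoNPow α
    positivity
  · have h1 := one_le_twoNPow α
    refine mul_le_mul_of_nonneg_left ?_ (by positivity)
    exact inv_anti₀ (by positivity) (pow_le_pow_right₀ h1 hqr)

/-- `S₋₁` is closed under the Wick product. -/
theorem IsKondratiev.wick {a b : MultiIndex → ℂ} (ha : IsKondratiev a) (hb : IsKondratiev b) :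
    IsKondratiev (wickCoeff a b) := by
  obtain ⟨q, hq, ha⟩ := ha
  obtain ⟨r, hr, hb⟩ := hb
  have ha' := IsKondratiev.of_le (le_max_left q r) ha
  have hb' := IsKondratiev.of_le (le_max_right q r) hb
  set N := max q r with hN
  refine ⟨N + 1, by omega, ?_⟩
  have hpos : ∀ α, 0 < twoNPow α := fun α => zero_lt_one.trans_le (one_le_twoNPow α)
  have hs := summable_sum_mul_antidiagonal_of_summable_mul
    (f := fun α => ‖a α‖ ^ 2 * (twoNPow α ^ N)⁻¹) (g := fun α => ‖b α‖ ^ 2 * (twoNPow α ^ N)⁻¹)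
    (ha'.mul_of_nonneg hb' (fun α => by have := hpos α; simp only [Pi.zero_apply]; positivity)
      (fun α => by have := hpos α; simp only [Pi.zero_apply]; positivity))
  refine Summable.of_nonneg_of_le (fun γ => by have := hpos γ; positivity) (fun γ => ?_) hs
  have h1 : ‖wickCoeff a b γ‖ ^ 2
      ≤ (Finset.HasAntidiagonal.antidiagonal γ).card * ∑ x ∈ Finset.HasAntidiagonal.antidiagonal γ, (‖a x.1‖ * ‖b x.2‖) ^ 2 := by
    refine le_trans ?_ sq_sum_le_card_mul_sum_sq
    refine pow_le_pow_left₀ (norm_nonneg _) ?_ 2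
    refine (norm_sum_le _ _).trans (le_of_eq ?_)
    simp
  have h2 : ∑ x ∈ Finset.HasAntidiagonal.antidiagonal γ,
      (‖a x.1‖ ^ 2 * (twoNPow x.1 ^ N)⁻¹) * (‖b x.2‖ ^ 2 * (twoNPow x.2 ^ N)⁻¹)
      = (∑ x ∈ Finset.HasAntidiagonal.antidiagonal γ, (‖a x.1‖ * ‖b x.2‖) ^ 2) * (twoNPow γ ^ N)⁻¹ := by
    rw [Finset.sum_mul]
    refine Finset.sum_congr rfl fun x hx => ?_
    have hx' : x.1 + x.2 = γ := by simpa using hx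
    rw [← hx', twoNPow_add, mul_pow, mul_pow, mul_inv]
    ring
  rw [h2]
  have h3 := hpos γ
  have h4 : ‖wickCoeff a b γ‖ ^ 2
      ≤ twoNPow γ * ∑ x ∈ Finset.HasAntidiagonal.antidiagonal γ, (‖a x.1‖ * ‖b x.2‖) ^ 2 :=
    h1.trans (mul_le_mul_of_nonneg_right (card_antidiagonal_le γ)
      (Finset.sum_nonneg fun _ _ => by positivity))
  rw [pow_succ (twoNPow γ), mul_inv]
  calc ‖wickCoeff a b γ‖ ^ 2 * ((twoNPow γ ^ N)⁻¹ * (twoNPow γ)⁻¹)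
      ≤ (twoNPow γ * ∑ x ∈ Finset.HasAntidiagonal.antidiagonal γ, (‖a x.1‖ * ‖b x.2‖) ^ 2)
        * ((twoNPow γ ^ N)⁻¹ * (twoNPow γ)⁻¹) :=
        mul_le_mul_of_nonneg_right h4 (by positivity)
    _ = _ := by field_simp

/-- The Wick product `Φ ⋄ Ψ` on `S₋₁`. -/
def Kondratiev.wick (Φ Ψ : Kondratiev) : Kondratiev :=
  ⟨wickCoeff Φ.1 Ψ.1, Φ.2.wick Ψ.2⟩

/-- The constant `1 = H_0`, the unit of the Wick product. -/
def Kondratiev.unit : Kondratiev :=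
  ⟨fun α => if α = 0 then 1 else 0, 1, le_rfl,
    summable_of_ne_finset_zero (s := {0}) fun α hα => by
      have : α ≠ 0 := by simpa using hα
      simp [this]⟩

/-- The Wick powers `Φ^{⋄n}` on `S₋₁`. -/
def Kondratiev.wickPow (Φ : Kondratiev) : ℕ → Kondratiev
  | 0 => Kondratiev.unit
  | n + 1 => (Kondratiev.wickPow Φ n).wick Φ

/-- `F^{⋄n} = G` for random variables `F, G ∈ L²(Ω, P)`, regarded as elements of `S₋₁` through
their chaos expansions: `F` has an expansion in `S₋₁`, and the `n`-th Wick power of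
(every) such expansion is an expansion of `G`. -/
def IsWickPower (P : Measure Omega) (n : ℕ) (F G : Omega → ℂ) : Prop :=
  (∃ Φ : Kondratiev, HasChaosExpansion P Φ.1 F) ∧
    ∀ Φ : Kondratiev, HasChaosExpansion P Φ.1 F → HasChaosExpansion P (Φ.wickPow n).1 G

/-- `n! ∑_{k=⌈n/2⌉}^{n} (-1/2)^{n-k} · x^{2k-n}/(2k-n)! · c^{n-k}/(n-k)!`. -/
def wickFormula (n : ℕ) (c x : ℂ) : ℂ :=
  n ! * ∑ k ∈ Finset.Icc ⌈(n : ℚ) / 2⌉₊ n,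
    (-1 / 2 : ℂ) ^ (n - k) * (x ^ (2 * k - n) / ((2 * k - n)! : ℂ)) * (c ^ (n - k) / ((n - k)! : ℂ))

end WhiteNoise

end

noncomputable section

namespace WhiteNoise

/-! ### Generating functions of Hermite polynomials -/

/-! Let `g = T_m f` have coordinates `g_k` in the Hermite functions, so that `Q_g = ∑ g_k H_{ε_k}`.
Wick multiplication adds multi-indices, so the multinomial theorem gives the coefficients `n! g^α /
α!` (`|α| = n`) of the `n`-th Wick power (`wickCoeff_wickMonomial`).

To see which random variable this is, form the generating function in `n`. For finitely many
coordinates with values `x_k` it is `∏ exp (g_k x_k T - g_k² T² / 2) = exp (x T - c T² / 2)`, where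
`x = ∑ g_k x_k` and `c = ∑ g_k²`; its coefficients are the claimed formula
(`sum_finsuppAntidiag_hermite`). The exponentials are handled as formal power series fixed by a
differential equation.

For infinitely many coordinates, the `H_α` are orthogonal with squared norm `α!`, so the chaos
series converges in `L²`. Along a subsequence it converges a.e., and continuity of the finite
formula identifies the limit (`hasChaosExpansion_wickFormula`). Here `c` becomes the bilinear
quantity `∫ g²`, which is `‖g‖²` for real `g`. Uniqueness of chaos coefficients makes the result
independent of the chosen expansion.

For `I_t`, the bound `|I_t^(u)|² ≤ (t² + 4) / (u² + 1)` gives membership in the domain, and an even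
`m` preserves Hermitian symmetry of the Fourier transform, so `T_m I_t` is real. -/

theorem derivative_hermite_succ (n : ℕ) :
    Polynomial.derivative (Polynomial.hermite (n + 1))
      = ((n : Polynomial ℤ) + 1) * Polynomial.hermite n := by
  induction n with
  | zero => simp
  | succ n ih =>
    rw [Polynomial.hermite_succ (n + 1), Polynomial.derivative_sub, Polynomial.derivative_mul, ih,
      Polynomial.derivative_mul, Polynomial.hermite_succ n]
    simp only [Polynomial.derivative_X, Polynomial.derivative_add, Polynomial.derivative_natCast,
      Polynomial.derivative_one]
    push_cast
    ring

/-- This three-term recurrence is the differential equation of the generating function, read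
coefficientwise. -/
theorem aeval_hermite_succ_succ {R : Type*} [CommRing R] (n : ℕ) (x : R) :
    Polynomial.aeval x (Polynomial.hermite (n + 2))
      = x * Polynomial.aeval x (Polynomial.hermite (n + 1))
        - (n + 1) * Polynomial.aeval x (Polynomial.hermite n) := by
  rw [Polynomial.hermite_succ (n + 1), derivative_hermite_succ]
  simp

/-- `A` is the power series `exp (x T - c T² / 2)`, characterised by a differential equation. -/
def IsHermiteSeries (c x : ℂ) (A : PowerSeries ℂ) : Prop :=
  PowerSeries.constantCoeff A = 1 ∧
    PowerSeries.derivative ℂ A = (PowerSeries.C x - PowerSeries.C c * PowerSeries.X) * A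

theorem IsHermiteSeries.one : IsHermiteSeries 0 0 1 := by
  constructor <;> simp

/-- By the Leibniz rule logarithmic derivatives add: the functional equation of `exp` without any
exponential series. -/
theorem IsHermiteSeries.mul {c d x y : ℂ} {A B : PowerSeries ℂ} (hA : IsHermiteSeries c x A)
    (hB : IsHermiteSeries d y B) : IsHermiteSeries (c + d) (x + y) (A * B) := by
  refine ⟨by simp [hA.1, hB.1], ?_⟩
  rw [Derivation.leibniz, hA.2, hB.2]
  simp only [smul_eq_mul, map_add]
  ring

theorem IsHermiteSeries.prod {ι : Type*} (s : Finset ι) {c x : ι → ℂ} {A : ι → PowerSeries ℂ}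
    (h : ∀ i, IsHermiteSeries (c i) (x i) (A i)) :
    IsHermiteSeries (∑ i ∈ s, c i) (∑ i ∈ s, x i) (∏ i ∈ s, A i) := by
  classical
  induction s using Finset.induction_on with
  | empty => simpa using IsHermiteSeries.one
  | insert i s hi ih =>
    rw [Finset.sum_insert hi, Finset.sum_insert hi, Finset.prod_insert hi]
    exact (h i).mul ih

theorem IsHermiteSeries.coeff_one {c x : ℂ} {A : PowerSeries ℂ} (hA : IsHermiteSeries c x A) :
    PowerSeries.coeff 1 A = x := by
  have h := congrArg (PowerSeries.coeff 0) hA.2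
  rw [PowerSeries.coeff_derivative] at h
  simpa [hA.1] using h

theorem IsHermiteSeries.coeff_succ_succ {c x : ℂ} {A : PowerSeries ℂ}
    (hA : IsHermiteSeries c x A) (n : ℕ) :
    PowerSeries.coeff (n + 2) A * (n + 2)
      = x * PowerSeries.coeff (n + 1) A - c * PowerSeries.coeff n A := by
  have h := congrArg (PowerSeries.coeff (n + 1)) hA.2
  rw [PowerSeries.coeff_derivative, sub_mul, map_sub, mul_assoc, PowerSeries.coeff_C_mul,
    PowerSeries.coeff_C_mul, PowerSeries.coeff_succ_X_mul] at h
  rw [← h]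
  push_cast
  ring

/-- The equation is a two-step recurrence for the coefficients, so the induction carries two
consecutive ones. -/
theorem IsHermiteSeries.unique {c x : ℂ} {A B : PowerSeries ℂ} (hA : IsHermiteSeries c x A)
    (hB : IsHermiteSeries c x B) : A = B := by
  have h : ∀ n, PowerSeries.coeff n A = PowerSeries.coeff n B ∧
      PowerSeries.coeff (n + 1) A = PowerSeries.coeff (n + 1) B := by
    intro n
    induction n with
    | zero =>
      refine ⟨?_, by rw [zero_add, hA.coeff_one, hB.coeff_one]⟩
      rw [PowerSeries.coeff_zero_eq_constantCoeff, hA.1, hB.1]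
    | succ n ih =>
      refine ⟨ih.2, ?_⟩
      have h2 : ((n : ℂ) + 2) ≠ 0 := by exact_mod_cast (by omega : n + 2 ≠ 0)
      refine mul_right_cancel₀ h2 ?_
      rw [show n + 1 + 1 = n + 2 from rfl, hA.coeff_succ_succ, hB.coeff_succ_succ, ih.1, ih.2]
  ext n
  exact (h n).1

theorem isHermiteSeries_of_coeff {c x : ℂ} {a : ℕ → ℂ} (h0 : a 0 = 1) (h1 : a 1 = x)
    (h : ∀ n, a (n + 2) * (n + 2) = x * a (n + 1) - c * a n) :
    IsHermiteSeries c x (PowerSeries.mk a) := by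
  refine ⟨by simp [h0], ?_⟩
  ext n
  rw [PowerSeries.coeff_derivative, sub_mul, map_sub, mul_assoc, PowerSeries.coeff_C_mul,
    PowerSeries.coeff_C_mul]
  cases n with
  | zero => simp [h0, h1]
  | succ n =>
    rw [PowerSeries.coeff_succ_X_mul]
    simp only [PowerSeries.coeff_mk]
    rw [← h]
    push_cast
    ring

/-- The generating function `∑ gⁿ h_n(x) Tⁿ / n!`. -/
theorem isHermiteSeries_hermite (g : ℂ) (x : ℝ) :
    IsHermiteSeries (g ^ 2) (g * x) (PowerSeries.mk fun n =>
      g ^ n * ((Polynomial.aeval x (Polynomial.hermite n) : ℝ) : ℂ) / n !) := by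
  refine isHermiteSeries_of_coeff (by simp) (by simp) fun n => ?_
  rw [aeval_hermite_succ_succ, Nat.factorial_succ (n + 1), Nat.factorial_succ n]
  have h1 : ((n : ℂ) + 1 + 1) ≠ 0 := by exact_mod_cast (by omega : n + 1 + 1 ≠ 0)
  have h2 : ((n : ℂ) + 1) ≠ 0 := by exact_mod_cast (by omega : n + 1 ≠ 0)
  have h3 : (n ! : ℂ) ≠ 0 := by exact_mod_cast n.factorial_ne_zero
  push_cast
  field_simp
  ring

/-- The power series `exp (x T)`. -/
theorem isHermiteSeries_exp (x : ℂ) :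
    IsHermiteSeries 0 x (PowerSeries.mk fun n => x ^ n / n !) := by
  refine isHermiteSeries_of_coeff (by simp) (by simp) fun n => ?_
  rw [Nat.factorial_succ (n + 1)]
  have h1 : ((n : ℂ) + 1 + 1) ≠ 0 := by exact_mod_cast (by omega : n + 1 + 1 ≠ 0)
  have h3 : ((n + 1)! : ℂ) ≠ 0 := by exact_mod_cast (n + 1).factorial_ne_zero
  push_cast
  field_simp
  ring

/-- The power series `exp (- c T² / 2)`. -/
theorem isHermiteSeries_exp_sq (c : ℂ) :
    IsHermiteSeries c 0 (PowerSeries.mk fun n =>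
      if Even n then (-1 / 2 : ℂ) ^ (n / 2) * (c ^ (n / 2) / (n / 2)!) else 0) := by
  refine isHermiteSeries_of_coeff (by simp) (by simp) fun n => ?_
  by_cases hn : Even n
  · obtain ⟨k, rfl⟩ := hn
    have e1 : (k + k) / 2 = k := by omega
    have e2 : (k + k + 2) / 2 = k + 1 := by omega
    have e3 : Even (k + k + 2) := ⟨k + 1, by omega⟩
    have e4 : Even (k + k) := ⟨k, rfl⟩
    rw [if_pos e3, if_pos e4, e1, e2, Nat.factorial_succ]
    have h2 : ((k : ℂ) + 1) ≠ 0 := by exact_mod_cast (by omega : k + 1 ≠ 0)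
    have h3 : (k ! : ℂ) ≠ 0 := by exact_mod_cast k.factorial_ne_zero
    push_cast
    field_simp
    ring
  · have e3 : ¬ Even (n + 2) := by rwa [Nat.even_add_one, Nat.even_add_one, not_not]
    rw [if_neg e3, if_neg hn]
    simp

/-- In the Cauchy product only pairs with even second entry survive. Writing that entry as `2 * (n -
k)` leaves `2 * k - n` for the first, and its nonnegativity is the lower limit `⌈n/2⌉`. -/
theorem coeff_exp_mul_exp_sq (n : ℕ) (c x : ℂ) :
    PowerSeries.coeff n ((PowerSeries.mk fun n => x ^ n / (n ! : ℂ)) * (PowerSeries.mk fun n =>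
      if Even n then (-1 / 2 : ℂ) ^ (n / 2) * (c ^ (n / 2) / (n / 2)!) else 0))
      = wickFormula n c x / n ! := by
  have h3 : (n ! : ℂ) ≠ 0 := by exact_mod_cast n.factorial_ne_zero
  rw [wickFormula, mul_div_cancel_left₀ _ h3, PowerSeries.coeff_mul]
  -- Without the ceiling, the truncated subtractions below become linear arithmetic.
  have hmem : ∀ k, k ∈ Finset.Icc ⌈(n : ℚ) / 2⌉₊ n ↔ n ≤ 2 * k ∧ k ≤ n := by
    intro k
    rw [Finset.mem_Icc, Nat.ceil_le, div_le_iff₀ (by norm_num)]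
    refine and_congr_left fun _ => ?_
    rw [mul_comm]
    exact_mod_cast Iff.rfl
  symm
  refine Finset.sum_of_injOn (fun k => (2 * k - n, 2 * (n - k))) ?_ ?_ ?_ ?_
  · intro k hk l hl h
    have h1 := (hmem k).1 hk
    have h2 := (hmem l).1 hl
    have h3 := congrArg Prod.snd h
    simp only at h3
    omega
  · intro k hk
    have h1 := (hmem k).1 hk
    rw [Finset.mem_coe, Finset.HasAntidiagonal.mem_antidiagonal]
    simp only
    omega
  · rintro ⟨p, q⟩ hpq hnot
    rw [Finset.HasAntidiagonal.mem_antidiagonal] at hpq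
    simp only at hpq
    simp only [PowerSeries.coeff_mk]
    rw [if_neg, mul_zero]
    rintro ⟨k, rfl⟩
    refine hnot ⟨n - k, (hmem _).2 (by omega), ?_⟩
    simp only [Prod.mk.injEq]
    omega
  · intro k hk
    have e1 : 2 * (n - k) / 2 = n - k := by omega
    simp only [PowerSeries.coeff_mk, e1, if_pos (even_two_mul (n - k))]
    ring

/-- The generating function `∑ wickFormula n c x Tⁿ / n! = exp (x T - c T² / 2)`. -/
theorem isHermiteSeries_wickFormula (c x : ℂ) :
    IsHermiteSeries c x (PowerSeries.mk fun n => wickFormula n c x / n !) := by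
  have h := (isHermiteSeries_exp x).mul (isHermiteSeries_exp_sq c)
  rw [zero_add, add_zero] at h
  convert! h using 1
  ext n
  rw [coeff_exp_mul_exp_sq, PowerSeries.coeff_mk]

/-- The multinomial theorem for Hermite polynomials. -/
theorem sum_finsuppAntidiag_hermite (s : Finset ℕ) (n : ℕ) (g : ℕ → ℂ) (x : ℕ → ℝ) :
    ∑ α ∈ s.finsuppAntidiag n, ∏ k ∈ s,
        (g k ^ α k * ((Polynomial.aeval (x k) (Polynomial.hermite (α k)) : ℝ) : ℂ) / (α k)!)
      = wickFormula n (∑ k ∈ s, g k ^ 2) (∑ k ∈ s, g k * x k) / n ! := by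
  have h := (IsHermiteSeries.prod s fun k => isHermiteSeries_hermite (g k) (x k)).unique
    (isHermiteSeries_wickFormula _ _)
  have h2 := congrArg (PowerSeries.coeff n) h
  rw [PowerSeries.coeff_prod] at h2
  simpa only [PowerSeries.coeff_mk] using h2

theorem continuous_wickFormula (n : ℕ) :
    Continuous fun z : ℂ × ℂ => wickFormula n z.1 z.2 := by
  unfold wickFormula
  fun_prop

/-- With this, the expansion of `Q_g` itself is the case `n = 1` of the general expansion. -/
theorem wickFormula_one (c x : ℂ) : wickFormula 1 c x = x := by
  have h := (isHermiteSeries_wickFormula c x).coeff_one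
  simpa using h

/-! ### Hermite polynomials and the Gaussian weight -/

theorem integrable_polynomial_mul_gaussian (p : Polynomial ℝ) :
    Integrable fun x : ℝ => p.eval x * Real.exp (-(x ^ 2 / 2)) := by
  -- The extra factor `1 + X²` turns a uniform bound into domination by `C / (1 + x²)`.
  obtain ⟨C, hC⟩ := gaussian_decay (p * (1 + Polynomial.X ^ 2))
  refine (integrable_inv_one_add_sq.const_mul C).mono' (by fun_prop) (Eventually.of_forall ?_)
  intro x
  have h := hC x
  have h1 : (0 : ℝ) < 1 + x ^ 2 := by positivity
  rw [Polynomial.eval_mul, abs_mul] at h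
  simp only [Polynomial.eval_add, Polynomial.eval_one, Polynomial.eval_pow,
    Polynomial.eval_X, abs_of_pos h1] at h
  rw [← div_eq_mul_inv, le_div_iff₀ h1, norm_mul, Real.norm_eq_abs, Real.norm_eq_abs, Real.abs_exp]
  linarith

/-- Integration by parts: `(p' - X p) exp (-x²/2)` is the derivative of an integrable function,
hence has integral zero. -/
theorem integral_deriv_polynomial_mul_gaussian (p : Polynomial ℝ) :
    ∫ x : ℝ, (Polynomial.X * p).eval x * Real.exp (-(x ^ 2 / 2))
      = ∫ x : ℝ, p.derivative.eval x * Real.exp (-(x ^ 2 / 2)) := by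
  have hd : ∀ x : ℝ, HasDerivAt (fun x : ℝ => p.eval x * Real.exp (-(x ^ 2 / 2)))
      ((p.derivative - Polynomial.X * p).eval x * Real.exp (-(x ^ 2 / 2))) x := by
    intro x
    have h1 : HasDerivAt (fun x : ℝ => -(x ^ 2 / 2)) (-x) x := by
      refine ((hasDerivAt_pow 2 x).div_const 2).fun_neg.congr_deriv ?_
      simp
    refine ((p.hasDerivAt x).mul h1.exp).congr_deriv ?_
    rw [Polynomial.eval_sub, Polynomial.eval_mul, Polynomial.eval_X]
    ring
  have h := integral_eq_zero_of_hasDerivAt_of_integrable hd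
    (integrable_polynomial_mul_gaussian _) (integrable_polynomial_mul_gaussian p)
  simp only [Polynomial.eval_sub, sub_mul] at h
  rw [integral_sub (integrable_polynomial_mul_gaussian _) (integrable_polynomial_mul_gaussian _),
    sub_eq_zero] at h
  exact h.symm

/-- The probabilists' Hermite polynomials with real coefficients. -/
def hermiteReal (n : ℕ) : Polynomial ℝ := (Polynomial.hermite n).map (Int.castRingHom ℝ)

theorem eval_hermiteReal (n : ℕ) (x : ℝ) :
    (hermiteReal n).eval x = Polynomial.aeval x (Polynomial.hermite n) := by
  rw [hermiteReal, Polynomial.eval_map, Polynomial.aeval_def]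
  rfl

theorem hermiteReal_succ (n : ℕ) :
    hermiteReal (n + 1) = Polynomial.X * hermiteReal n - Polynomial.derivative (hermiteReal n) := by
  rw [hermiteReal, Polynomial.hermite_succ]
  simp [hermiteReal]

theorem monic_hermiteReal (n : ℕ) : (hermiteReal n).Monic := (Polynomial.hermite_monic n).map _

theorem natDegree_hermiteReal (n : ℕ) : (hermiteReal n).natDegree = n := by
  rw [hermiteReal, (Polynomial.hermite_monic n).natDegree_map, Polynomial.natDegree_hermite]

/-- For the Gaussian weight, `X - d/dx` is adjoint to `d/dx`, and `h_n` is its `n`-th iterate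
applied to `1`. -/
theorem integral_hermiteReal_mul (n : ℕ) (p : Polynomial ℝ) :
    ∫ x : ℝ, (hermiteReal n * p).eval x * Real.exp (-(x ^ 2 / 2))
      = ∫ x : ℝ, (Polynomial.derivative^[n] p).eval x * Real.exp (-(x ^ 2 / 2)) := by
  induction n generalizing p with
  | zero => simp [hermiteReal]
  | succ n ih =>
    have h1 : hermiteReal (n + 1) * p = Polynomial.X * (hermiteReal n * p)
        - Polynomial.derivative (hermiteReal n) * p := by
      rw [hermiteReal_succ]
      ring
    have h2 := integral_deriv_polynomial_mul_gaussian (hermiteReal n * p)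
    rw [Polynomial.derivative_mul] at h2
    rw [h1, Function.iterate_succ_apply, ← ih]
    simp only [Polynomial.eval_sub, sub_mul]
    rw [integral_sub (integrable_polynomial_mul_gaussian _) (integrable_polynomial_mul_gaussian _),
      h2]
    simp only [Polynomial.eval_add, add_mul]
    rw [integral_add (integrable_polynomial_mul_gaussian _) (integrable_polynomial_mul_gaussian _)]
    ring

theorem integral_exp_neg_sq_div_two : ∫ x : ℝ, Real.exp (-(x ^ 2 / 2)) = √(2 * Real.pi) := by
  have h := integral_gaussian (1 / 2)
  rw [show Real.pi / (1 / 2) = 2 * Real.pi by ring] at h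
  rw [← h]
  refine integral_congr_ae (Eventually.of_forall fun x => ?_)
  simp only
  congr 1
  ring

/-- For `b ≤ a`, the `a`-th derivative of the monic polynomial `h_b` is `a!` if `a = b` and zero
otherwise. -/
theorem integral_hermiteReal_mul_hermiteReal (a b : ℕ) :
    ∫ x : ℝ, (hermiteReal a).eval x * (hermiteReal b).eval x * Real.exp (-(x ^ 2 / 2))
      = if a = b then a ! * √(2 * Real.pi) else 0 := by
  wlog hab : b ≤ a generalizing a b
  · have h := this b a (by omega)
    simp only [mul_comm ((hermiteReal a).eval _)]
    rw [h]
    have : a ≠ b := by omega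
    simp [this, this.symm]
  have h := integral_hermiteReal_mul a (hermiteReal b)
  simp only [Polynomial.eval_mul] at h
  rw [h]
  by_cases hne : a = b
  · subst hne
    have h2 : Polynomial.derivative^[a] (hermiteReal a) = Polynomial.C (a ! : ℝ) := by
      refine Polynomial.ext fun i => ?_
      rw [Polynomial.coeff_iterate_derivative, Polynomial.coeff_C]
      by_cases hi : i = 0
      · subst hi
        have h3 := (monic_hermiteReal a).coeff_natDegree
        rw [natDegree_hermiteReal] at h3
        simp [h3, Nat.descFactorial_self]
      · rw [if_neg hi, Polynomial.coeff_eq_zero_of_natDegree_lt, smul_zero]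
        rw [natDegree_hermiteReal]
        omega
    simp only [h2, Polynomial.eval_C, if_true]
    rw [integral_const_mul, integral_exp_neg_sq_div_two]
  · rw [if_neg hne, Polynomial.iterate_derivative_eq_zero (by rw [natDegree_hermiteReal]; omega)]
    simp

theorem integral_gaussianReal_hermite_mul_hermite (a b : ℕ) :
    ∫ x : ℝ, (hermiteReal a).eval x * (hermiteReal b).eval x ∂(ProbabilityTheory.gaussianReal 0 1)
      = if a = b then (a ! : ℝ) else 0 := by
  rw [ProbabilityTheory.integral_gaussianReal_eq_integral_smul one_ne_zero]
  have h := integral_hermiteReal_mul_hermiteReal a b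
  have hpi : √(2 * Real.pi) ≠ 0 := by positivity
  have h1 : ∀ x : ℝ, ProbabilityTheory.gaussianPDFReal 0 1 x
      • ((hermiteReal a).eval x * (hermiteReal b).eval x)
      = (√(2 * Real.pi))⁻¹
        * ((hermiteReal a).eval x * (hermiteReal b).eval x * Real.exp (-(x ^ 2 / 2))) := by
    intro x
    rw [ProbabilityTheory.gaussianPDFReal_def]
    simp only [NNReal.coe_one, mul_one, sub_zero, smul_eq_mul, neg_div]
    ring
  simp only [h1]
  rw [integral_const_mul, h]
  split_ifs
  · field_simp
  · simp

theorem integrable_gaussianReal_polynomial (p : Polynomial ℝ) :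
    Integrable (fun x : ℝ => p.eval x) (ProbabilityTheory.gaussianReal 0 1) := by
  simp only [Polynomial.eval_eq_sum_range]
  refine integrable_finsetSum _ fun i _ => Integrable.const_mul ?_ _
  have h := (ProbabilityTheory.memLp_id_gaussianReal (μ := 0) (v := 1) i).integrable_norm_pow'
  simp only [id, ← norm_pow] at h
  exact (integrable_norm_iff (by fun_prop)).1 h

/-! ### The Fourier transform of square integrable functions -/

/-- The `L²` transform agrees with that of the associated tempered distribution, which is defined by
duality. -/
theorem integral_mul_fourier_eq (f : L2R) (η : 𝓢(ℝ, ℂ)) :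
    ∫ x, η x * (𝓕 f : L2R) x = ∫ x, (𝓕 η) x * f x := by
  have h := congrArg (fun T => T η) (Lp.fourier_toTemperedDistribution_eq f)
  simp only [TemperedDistribution.fourier_apply, Lp.toTemperedDistribution_apply, smul_eq_mul] at h
  exact h.symm

theorem integral_schwartz_mul_fourier_eq {f : ℝ → ℂ} (hf : Integrable f) (η : 𝓢(ℝ, ℂ)) :
    ∫ x, η x * 𝓕 f x = ∫ x, (𝓕 η) x * f x := by
  have h := VectorFourier.integral_fourierIntegral_smul_eq_flip (μ := volume) (ν := volume)
    (L := innerₗ ℝ) Real.continuous_fourierChar (by fun_prop) hf (η.integrable)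
  simp only [smul_eq_mul, flip_innerₗ] at h
  simp only [SchwartzMap.fourier_coe, mul_comm (η _), mul_comm _ (f _)]
  exact h

/-- On `L¹ ∩ L²` the `L²` Fourier transform is given by the Fourier integral. -/
theorem fourier_toLp_ae_eq {f : ℝ → ℂ} (h1 : Integrable f) (h2 : MemLp f 2 volume) :
    (𝓕 (h2.toLp f) : L2R) =ᵐ[volume] 𝓕 f := by
  refine ae_eq_of_integral_contDiff_smul_eq ?_ ?_ ?_
  · exact (Lp.memLp _).locallyIntegrable (by norm_num)
  · exact (VectorFourier.fourierIntegral_continuous Real.continuous_fourierChar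
      (L := innerₗ ℝ) (by fun_prop) h1).locallyIntegrable
  -- Against a test function both transforms move onto the test function, where they see the same
  -- `f`.
  · intro g g_smooth g_cpt
    have hg₁ : HasCompactSupport (Complex.ofRealCLM ∘ g) := g_cpt.comp_left rfl
    have hg₂ : ContDiff ℝ (⊤ : ℕ∞) (Complex.ofRealCLM ∘ g) := by fun_prop
    have e1 := integral_mul_fourier_eq (h2.toLp f) (hg₁.toSchwartzMap hg₂)
    have e2 := integral_schwartz_mul_fourier_eq h1 (hg₁.toSchwartzMap hg₂)
    have e3 : ∫ x, (𝓕 (hg₁.toSchwartzMap hg₂)) x * (h2.toLp f) x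
        = ∫ x, (𝓕 (hg₁.toSchwartzMap hg₂)) x * f x := by
      refine integral_congr_ae ?_
      filter_upwards [h2.coeFn_toLp] with x hx
      rw [hx]
    rw [e3, ← e2] at e1
    simpa using e1

theorem fourierInv_symm_of_real {η : ℝ → ℂ} (hη : ∀ x, (starRingEnd ℂ) (η x) = η x) (ξ : ℝ) :
    (starRingEnd ℂ) (𝓕⁻ η ξ) = 𝓕⁻ η (-ξ) := by
  rw [Real.fourierInv_eq', Real.fourierInv_eq', ← integral_conj]
  refine integral_congr_ae (Eventually.of_forall fun x => ?_)
  simp only [smul_eq_mul, map_mul, hη, ← Complex.exp_conj, Complex.conj_ofReal, Complex.conj_I]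
  congr 2
  simp

theorem fourier_symm_of_real {η : ℝ → ℂ} (hη : ∀ x, (starRingEnd ℂ) (η x) = η x) (ξ : ℝ) :
    𝓕 η (-ξ) = (starRingEnd ℂ) (𝓕 η ξ) := by
  have h := fourierInv_symm_of_real hη (-ξ)
  rw [neg_neg, Real.fourierInv_eq_fourier_neg, Real.fourierInv_eq_fourier_neg, neg_neg] at h
  exact h.symm

theorem ae_neg {p : ℝ → Prop} (h : ∀ᵐ x : ℝ, p x) : ∀ᵐ x : ℝ, p (-x) := by
  have := (quasi_scale (c := -1) (by norm_num)).ae h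
  simpa using this

/-- A square integrable function with Hermitian Fourier transform is real valued. -/
theorem im_eq_zero_of_fourier_symm {g : L2R}
    (hg : ∀ᵐ ξ : ℝ, (𝓕 g : L2R) (-ξ) = (starRingEnd ℂ) ((𝓕 g : L2R) ξ)) :
    ∀ᵐ x : ℝ, (g x).im = 0 := by
  refine ae_eq_zero_of_integral_contDiff_smul_eq_zero ?_ ?_
  · exact ((Lp.memLp g).im).locallyIntegrable (by norm_num)
  · intro η η_smooth η_cpt
    have h₁ : HasCompactSupport (Complex.ofRealCLM ∘ η) := η_cpt.comp_left rfl
    have h₂ : ContDiff ℝ (⊤ : ℕ∞) (Complex.ofRealCLM ∘ η) := by fun_prop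
    set Θ : 𝓢(ℝ, ℂ) := h₁.toSchwartzMap h₂ with hΘ
    have hΘx : ∀ x, Θ x = (η x : ℂ) := fun x => rfl
    -- The pairing of `g` with a real test function is computed on the Fourier side. There both
    -- factors are Hermitian, so conjugation amounts to `ξ ↦ -ξ` and the integral is real.
    have e1 := integral_mul_fourier_eq g (𝓕⁻ Θ)
    rw [FourierTransform.fourier_fourierInv_eq] at e1
    have hsymm : ∀ ξ, (starRingEnd ℂ) ((𝓕⁻ Θ) ξ) = (𝓕⁻ Θ) (-ξ) := by
      intro ξ
      rw [SchwartzMap.fourierInv_coe]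
      exact fourierInv_symm_of_real (fun x => by rw [hΘx, Complex.conj_ofReal]) ξ
    have e2 : (starRingEnd ℂ) (∫ x, (𝓕⁻ Θ) x * (𝓕 g : L2R) x)
        = ∫ x, (𝓕⁻ Θ) x * (𝓕 g : L2R) x := by
      rw [← integral_conj, 
        ← integral_neg_eq_self (fun x : ℝ => (𝓕⁻ Θ : 𝓢(ℝ, ℂ)) x * (𝓕 g : L2R) x)]
      refine integral_congr_ae ?_
      filter_upwards [hg] with ξ hξ
      rw [map_mul, hsymm, hξ]
    rw [e1] at e2
    have hint : Integrable fun x => Θ x * g x :=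
      (Θ.memLp 2 volume).integrable_mul (Lp.memLp g)
    have e3 : (∫ x, Θ x * g x).im = ∫ x, η x • (g x).im := by
      rw [← Complex.imCLM_apply, ← ContinuousLinearMap.integral_comp_comm _ hint]
      refine integral_congr_ae (Eventually.of_forall fun x => ?_)
      simp [hΘx]
    rw [← e3]
    exact Complex.conj_eq_iff_im.1 e2

/-! ### The interval indicator lies in the domain of `T_m` -/

theorem intervalIndicator_integrable (t : ℝ) :
    Integrable ((Set.uIcc (0 : ℝ) t).indicator fun _ => (1 : ℂ)) :=
  (integrable_indicator_iff measurableSet_uIcc).2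
    (integrableOn_const (isCompact_uIcc.measure_lt_top.ne))

theorem fourier_intervalL2 (t : ℝ) :
    (𝓕 (intervalL2 t) : L2R) =ᵐ[volume] 𝓕 ((Set.uIcc (0 : ℝ) t).indicator fun _ => (1 : ℂ)) :=
  fourier_toLp_ae_eq (intervalIndicator_integrable t)
    (memLp_indicator_const 2 measurableSet_uIcc (1 : ℂ) (Or.inr isCompact_uIcc.measure_lt_top.ne))

/-- The length of the interval gives `‖A‖ ≤ |t|`, and the explicit antiderivative gives `‖A‖ |u| ≤
2`. The squares are added. -/
theorem norm_fourier_intervalIndicator_sq_le (t u : ℝ) :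
    ‖𝓕 ((Set.uIcc (0 : ℝ) t).indicator fun _ => (1 : ℂ)) (u / (2 * Real.pi))‖ ^ 2
      ≤ (t ^ 2 + 4) / (u ^ 2 + 1) := by
  set A := 𝓕 ((Set.uIcc (0 : ℝ) t).indicator fun _ => (1 : ℂ)) (u / (2 * Real.pi)) with hA
  have h0 : A = ∫ v in Set.uIcc (0 : ℝ) t, Complex.exp ((-(u : ℂ) * Complex.I) * v) := by
    rw [hA, Real.fourier_eq', ← integral_indicator measurableSet_uIcc]
    refine integral_congr_ae (Eventually.of_forall fun v => ?_)
    have hpi : (Real.pi : ℂ) ≠ 0 := by exact_mod_cast Real.pi_ne_zero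
    by_cases hv : v ∈ Set.uIcc (0 : ℝ) t
    · simp only [Set.indicator_of_mem hv, smul_eq_mul, mul_one]
      congr 1
      simp only [RCLike.inner_apply, conj_trivial]
      push_cast
      field_simp
    · simp only [Set.indicator_of_notMem hv, smul_zero]
  have h1 : ‖A‖ = ‖∫ v in (0 : ℝ)..t, Complex.exp ((-(u : ℂ) * Complex.I) * v)‖ := by
    rw [h0, intervalIntegral.norm_intervalIntegral_eq, Set.uIcc, Set.uIoc,
      integral_Icc_eq_integral_Ioc]
  have hn : ∀ v : ℝ, ‖Complex.exp ((-(u : ℂ) * Complex.I) * v)‖ = 1 := by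
    intro v
    rw [Complex.norm_exp]
    simp
  have h2 : ‖A‖ ≤ |t| := by
    rw [h1]
    have := intervalIntegral.norm_integral_le_of_norm_le_const (a := 0) (b := t) (C := 1)
      (f := fun v : ℝ => Complex.exp ((-(u : ℂ) * Complex.I) * v)) (fun v _ => (hn v).le)
    simpa using this
  have h3 : ‖A‖ * |u| ≤ 2 := by
    by_cases hu : u = 0
    · simp [hu]
    · have hc : (-(u : ℂ) * Complex.I) ≠ 0 := by simp [hu]
      rw [h1, integral_exp_mul_complex hc, norm_div]
      have e : ‖(-(u : ℂ) * Complex.I)‖ = |u| := by simp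
      rw [e, div_mul_cancel₀ _ (abs_ne_zero.2 hu)]
      refine (norm_sub_le _ _).trans ?_
      rw [hn, hn]
      norm_num
  rw [le_div_iff₀ (by positivity)]
  have h4 : ‖A‖ ^ 2 ≤ t ^ 2 := by
    rw [← sq_abs t]
    exact pow_le_pow_left₀ (norm_nonneg _) h2 2
  have h5 : (‖A‖ * |u|) ^ 2 ≤ 2 ^ 2 := pow_le_pow_left₀ (by positivity) h3 2
  rw [mul_pow, sq_abs] at h5
  linarith

theorem intervalL2_mem_domain {m : ℝ → ℝ} (hm : Measurable m) (hm0 : ∀ u, 0 ≤ m u)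
    (hmint : Integrable (fun u : ℝ => m u / (u ^ 2 + 1))) (t : ℝ) :
    intervalL2 t ∈ (Tm m).domain := by
  rw [mem_domain_Tm hm hm0]
  have hpi : (2 * Real.pi)⁻¹ ≠ 0 := by positivity
  refine lt_of_le_of_lt (lintegral_mono_ae ?_)
    ((hmint.const_mul (t ^ 2 + 4)).lintegral_lt_top)
  filter_upwards [(quasi_scale hpi).ae (fourier_intervalL2 t)] with u hu
  refine ENNReal.ofReal_le_ofReal ?_
  rw [show (2 * Real.pi)⁻¹ * u = u / (2 * Real.pi) by ring] at hu
  rw [hat, hu]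
  refine (mul_le_mul_of_nonneg_left (norm_fourier_intervalIndicator_sq_le t u) (hm0 u)).trans
    (le_of_eq ?_)
  ring

/-- `T_m I_t` is real valued if `m` is even. -/
theorem im_Tm_intervalL2_eq_zero {m : ℝ → ℝ} {t : ℝ} (ht : intervalL2 t ∈ (Tm m).domain)
    (heven : ∀ᵐ u : ℝ, m (-u) = m u) :
    ∀ᵐ x : ℝ, ((Tm m ⟨intervalL2 t, ht⟩ : L2R) x).im = 0 := by
  refine im_eq_zero_of_fourier_symm ?_
  have h0 : (𝓕 (Tm m ⟨intervalL2 t, ht⟩) : L2R) = (memLp_of_mem_domTm ht).toLp _ :=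
    (Lp.fourierTransformₗᵢ ℝ ℂ).apply_symm_apply _
  have h1 : ∀ᵐ ξ : ℝ, (𝓕 (Tm m ⟨intervalL2 t, ht⟩) : L2R) ξ = (√(m (2 * Real.pi * ξ)) : ℂ)
      * 𝓕 ((Set.uIcc (0 : ℝ) t).indicator fun _ => (1 : ℂ)) ξ := by
    rw [h0]
    filter_upwards [(memLp_of_mem_domTm ht).coeFn_toLp, fourier_intervalL2 t] with ξ hξ hξ'
    rw [hξ, mulSqrt, ← hξ']
    rfl
  have hpi : (2 * Real.pi) ≠ 0 := by positivity
  -- The multiplier is real and even and the indicator is real, so the product is Hermitian.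
  filter_upwards [h1, ae_neg h1, (quasi_scale hpi).ae heven] with ξ e1 e2 e3
  rw [e1, e2, mul_neg, e3, map_mul, Complex.conj_ofReal, fourier_symm_of_real]
  intro x
  by_cases hx : x ∈ Set.uIcc (0 : ℝ) t
  · simp [Set.indicator_of_mem hx]
  · simp [Set.indicator_of_notMem hx]

/-! ### The Hermite functions form an orthonormal basis -/

theorem memLp_polynomial_mul_gaussian (p : Polynomial ℝ) :
    MemLp (fun x : ℝ => p.eval (√2 * x) * Real.exp (-(x ^ 2 / 2))) 2 volume := by
  rw [memLp_two_iff_integrable_sq (by fun_prop)]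
  have h := (integrable_polynomial_mul_gaussian (p ^ 2)).comp_mul_left' (R := √2) (by positivity)
  refine h.congr (Eventually.of_forall fun x => ?_)
  simp only
  rw [Polynomial.eval_pow, mul_pow, mul_pow, Real.sq_sqrt (by norm_num), ← Real.exp_nat_mul]
  congr 2
  push_cast
  ring

/-- The Hermite functions in `L²(ℝ)`. -/
def hermiteL2 (j : ℕ) : Lp ℝ 2 (volume : Measure ℝ) := (hermiteFun j).toLp 2 volume

theorem hermiteL2_ae (j : ℕ) : hermiteL2 j =ᵐ[volume] fun x =>
    (hermiteReal j).eval (√2 * x) * Real.exp (-(x ^ 2 / 2)) / (Real.pi ^ (1 / 4 : ℝ) * √(j !)) := by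
  filter_upwards [(hermiteFun j).coeFn_toLp 2 volume] with x hx
  rw [hermiteL2, hx, hermiteFun_apply, eval_hermiteReal]

/-- The product of two factors `exp (-x²/2)` is the Gaussian weight at `√2 x`. The Jacobian `1/√2`
and the mass `√(2π)` combine to `√π`, which the normalisation removes. -/
theorem orthonormal_hermiteL2 : Orthonormal ℝ hermiteL2 := by
  classical
  rw [orthonormal_iff_ite]
  intro i j
  rw [L2.inner_def]
  have h1 : ∫ x, inner ℝ (hermiteL2 i x) (hermiteL2 j x)
      = ∫ x : ℝ, ((Real.pi ^ (1 / 4 : ℝ) * √(i !)) * (Real.pi ^ (1 / 4 : ℝ) * √(j !)))⁻¹ *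
        ((hermiteReal i).eval (√2 * x) * (hermiteReal j).eval (√2 * x)
          * Real.exp (-((√2 * x) ^ 2 / 2))) := by
    refine integral_congr_ae ?_
    filter_upwards [hermiteL2_ae i, hermiteL2_ae j] with x hi hj
    have e : Real.exp (-((√2 * x) ^ 2 / 2)) = Real.exp (-(x ^ 2 / 2)) * Real.exp (-(x ^ 2 / 2)) := by
      rw [← Real.exp_add, mul_pow, Real.sq_sqrt (by norm_num)]
      congr 1
      ring
    rw [hi, hj, e]
    simp only [RCLike.inner_apply, conj_trivial]
    field_simp
  rw [h1, integral_const_mul, Measure.integral_comp_mul_left (fun y : ℝ =>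
    (hermiteReal i).eval y * (hermiteReal j).eval y * Real.exp (-(y ^ 2 / 2))) (√2),
    integral_hermiteReal_mul_hermiteReal]
  split_ifs with hij
  · subst hij
    have e1 : (Real.pi ^ (1 / 4 : ℝ)) * (Real.pi ^ (1 / 4 : ℝ)) = √Real.pi := by
      rw [← Real.rpow_add Real.pi_pos, Real.sqrt_eq_rpow]
      norm_num
    have e2 : √(i ! : ℝ) * √(i ! : ℝ) = i ! := Real.mul_self_sqrt (by positivity)
    have e3 : (Real.pi ^ (1 / 4 : ℝ) * √(i !)) * (Real.pi ^ (1 / 4 : ℝ) * √(i !))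
        = √Real.pi * i ! := by
      rw [mul_mul_mul_comm, e1, e2]
    have h4 : (i ! : ℝ) ≠ 0 := by positivity
    have h5 : √Real.pi ≠ 0 := by positivity
    rw [e3, abs_of_pos (by positivity), Real.sqrt_mul (by norm_num), smul_eq_mul]
    field_simp
  · simp

/-! ### Completeness of the Hermite functions. -/

theorem integral_mul_hermite_eq_zero {f : Lp ℝ 2 (volume : Measure ℝ)}
    (hf : ∀ j, inner ℝ (hermiteL2 j) f = 0) (j : ℕ) :
    ∫ x, f x * ((hermiteReal j).eval (√2 * x) * Real.exp (-(x ^ 2 / 2))) = 0 := by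
  have h := hf j
  rw [L2.inner_def] at h
  have hc : (Real.pi ^ (1 / 4 : ℝ) * √(j !))⁻¹ ≠ 0 := by positivity
  have h1 : ∫ x, inner ℝ (hermiteL2 j x) (f x) = ∫ x, (Real.pi ^ (1 / 4 : ℝ) * √(j !))⁻¹ *
      (f x * ((hermiteReal j).eval (√2 * x) * Real.exp (-(x ^ 2 / 2)))) := by
    refine integral_congr_ae ?_
    filter_upwards [hermiteL2_ae j] with x hx
    rw [hx]
    simp only [RCLike.inner_apply, conj_trivial]
    ring
  rw [h1, integral_const_mul] at h
  exact (mul_eq_zero.1 h).resolve_left hc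

theorem integrable_mul_polynomial_mul_gaussian (f : Lp ℝ 2 (volume : Measure ℝ))
    (p : Polynomial ℝ) :
    Integrable fun x => f x * (p.eval (√2 * x) * Real.exp (-(x ^ 2 / 2))) :=
  (Lp.memLp f).integrable_mul (memLp_polynomial_mul_gaussian p)

/-- For `j = 0` the truncated index `j - 1` is harmless, since its coefficient vanishes. -/
theorem X_mul_hermiteReal (j : ℕ) :
    Polynomial.X * hermiteReal j
      = hermiteReal (j + 1) + Polynomial.C (j : ℝ) * hermiteReal (j - 1) := by
  rw [hermiteReal_succ]
  cases j with
  | zero => simp [hermiteReal]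
  | succ j =>
    have h := congrArg (Polynomial.map (Int.castRingHom ℝ)) (derivative_hermite_succ j)
    rw [← Polynomial.derivative_map] at h
    rw [hermiteReal, h]
    simp [hermiteReal]

/-- Multiplication by `X` preserves the span of the Hermite polynomials. Only `j = 0`, the vanishing
of all moments, is used later; the induction on `n` needs every `j`. -/
theorem integral_mul_X_pow_mul_hermite_eq_zero {f : Lp ℝ 2 (volume : Measure ℝ)}
    (hf : ∀ j, inner ℝ (hermiteL2 j) f = 0) (n j : ℕ) :
    ∫ x, f x * ((Polynomial.X ^ n * hermiteReal j).eval (√2 * x) * Real.exp (-(x ^ 2 / 2)))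
      = 0 := by
  induction n generalizing j with
  | zero => simpa using integral_mul_hermite_eq_zero hf j
  | succ n ih =>
    have h1 : Polynomial.X ^ (n + 1) * hermiteReal j = Polynomial.X ^ n * hermiteReal (j + 1)
        + Polynomial.C (j : ℝ) * (Polynomial.X ^ n * hermiteReal (j - 1)) := by
      rw [pow_succ, mul_assoc, X_mul_hermiteReal]
      ring
    have h2 : ∀ x, f x * ((Polynomial.X ^ (n + 1) * hermiteReal j).eval (√2 * x)
          * Real.exp (-(x ^ 2 / 2)))
        = f x * ((Polynomial.X ^ n * hermiteReal (j + 1)).eval (√2 * x)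
            * Real.exp (-(x ^ 2 / 2)))
          + j * (f x * ((Polynomial.X ^ n * hermiteReal (j - 1)).eval (√2 * x)
            * Real.exp (-(x ^ 2 / 2)))) := by
      intro x
      rw [h1, Polynomial.eval_add, Polynomial.eval_mul (p := Polynomial.C _), Polynomial.eval_C]
      ring
    simp only [h2]
    rw [integral_add (integrable_mul_polynomial_mul_gaussian f _)
      ((integrable_mul_polynomial_mul_gaussian f _).const_mul _), integral_const_mul, ih, ih]
    simp

/-- Half of the Gaussian exponent absorbs the exponential, as `|s x| ≤ s² + x²/4`; the other half is
square integrable. This is the dominating function for the next lemma. -/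
theorem integrable_mul_gaussian_mul_exp_abs (f : Lp ℝ 2 (volume : Measure ℝ)) (s : ℝ) :
    Integrable fun x => |f x| * Real.exp (-(x ^ 2 / 2)) * Real.exp |s * x| := by
  have h1 : MemLp (fun x : ℝ => Real.exp (-(x ^ 2 / 4))) 2 volume := by
    rw [memLp_two_iff_integrable_sq (by fun_prop)]
    have h := integrable_polynomial_mul_gaussian 1
    refine h.congr (Eventually.of_forall fun x => ?_)
    simp only [Polynomial.eval_one, one_mul]
    rw [← Real.exp_nat_mul]
    congr 1
    push_cast
    ring
  have h2 := ((Lp.memLp f).abs.integrable_mul h1).const_mul (Real.exp (s ^ 2))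
  refine h2.mono' ?_ (Eventually.of_forall fun x => ?_)
  · have := (Lp.aestronglyMeasurable f).norm
    simp only [Real.norm_eq_abs] at this
    exact (this.mul (by fun_prop)).mul (by fun_prop)
  · rw [Real.norm_eq_abs, abs_of_nonneg (by positivity)]
    simp only [Pi.mul_apply]
    change |f x| * Real.exp (-(x ^ 2 / 2)) * Real.exp |s * x|
      ≤ Real.exp (s ^ 2) * (|f x| * Real.exp (-(x ^ 2 / 4)))
    rw [mul_assoc, mul_left_comm (Real.exp (s ^ 2)), ← Real.exp_add, ← Real.exp_add]
    refine mul_le_mul_of_nonneg_left (Real.exp_le_exp.2 ?_) (abs_nonneg _)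
    rw [abs_mul]
    nlinarith [sq_nonneg (|s| - |x| / 2), sq_abs s, sq_abs x]

/-- Expand the exponential: each term is a vanishing moment, and dominated convergence allows
integration term by term. -/
theorem integral_mul_gaussian_mul_cexp_eq_zero {f : Lp ℝ 2 (volume : Measure ℝ)}
    (hf : ∀ j, inner ℝ (hermiteL2 j) f = 0) (s : ℝ) :
    ∫ x, Complex.exp (Complex.I * s * (√2 * x : ℝ)) * ((f x * Real.exp (-(x ^ 2 / 2)) : ℝ) : ℂ)
      = 0 := by
  -- The factor `hermiteReal 0 = 1` gives the term the shape of the moment lemma.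
  set F : ℕ → ℝ → ℂ := fun n x => (Complex.I * s) ^ n / n ! *
    ((f x * ((Polynomial.X ^ n * hermiteReal 0).eval (√2 * x)
      * Real.exp (-(x ^ 2 / 2))) : ℝ) : ℂ) with hF
  have hF0 : ∀ n, ∫ x, F n x = 0 := by
    intro n
    simp only [hF]
    rw [integral_const_mul, integral_complex_ofReal, integral_mul_X_pow_mul_hermite_eq_zero hf]
    simp
  have hFx : ∀ n x, F n x = (Complex.I * s * (√2 * x : ℝ)) ^ n / n !
      * ((f x * Real.exp (-(x ^ 2 / 2)) : ℝ) : ℂ) := by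
    intro n x
    simp only [hF, hermiteReal, Polynomial.hermite_zero]
    simp
    ring
  have hnorm : ∀ n x, ‖F n x‖
      = |s * √2 * x| ^ n / n ! * (|f x| * Real.exp (-(x ^ 2 / 2))) := by
    intro n x
    rw [hFx, norm_mul, norm_div, norm_pow, Complex.norm_real, Real.norm_eq_abs, abs_mul,
      Real.abs_exp]
    congr 2
    · congr 1
      simp [abs_mul, mul_assoc]
    · simp
  have hs : ∀ x, HasSum (fun n => |s * √2 * x| ^ n / n ! * (|f x| * Real.exp (-(x ^ 2 / 2))))
      (Real.exp |s * √2 * x| * (|f x| * Real.exp (-(x ^ 2 / 2)))) := by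
    intro x
    have h := NormedSpace.expSeries_div_hasSum_exp (𝔸 := ℝ) |s * √2 * x|
    rw [← Real.exp_eq_exp_ℝ] at h
    exact h.mul_right _
  have hsum := hasSum_integral_of_dominated_convergence (μ := (volume : Measure ℝ)) (F := F)
    (f := fun x => Complex.exp (Complex.I * s * (√2 * x : ℝ))
      * ((f x * Real.exp (-(x ^ 2 / 2)) : ℝ) : ℂ))
    (fun n x => |s * √2 * x| ^ n / n ! * (|f x| * Real.exp (-(x ^ 2 / 2))))
    (fun n => ((integrable_mul_polynomial_mul_gaussian f _).ofReal.const_mul _).aestronglyMeasurable)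
    (fun n => Eventually.of_forall fun x => (hnorm n x).le)
    (Eventually.of_forall fun x => (hs x).summable) ?_ ?_
  · simp only [hF0] at hsum
    exact hsum.unique hasSum_zero
  · simp only [fun x => (hs x).tsum_eq]
    refine (integrable_mul_gaussian_mul_exp_abs f (s * √2)).congr
      (Eventually.of_forall fun x => ?_)
    simp only
    ring
  · refine Eventually.of_forall fun x => ?_
    simp only [hFx]
    have h := NormedSpace.expSeries_div_hasSum_exp (𝔸 := ℂ) (Complex.I * s * (√2 * x : ℝ))
    rw [← Complex.exp_eq_exp_ℂ] at h
    exact h.mul_right _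

/-- The function `f exp (-x²/2)` lies in `L¹ ∩ L²` and has zero Fourier transform. It vanishes by
Plancherel, and the Gaussian has no zeros. -/
theorem eq_zero_of_inner_hermiteL2_eq_zero {f : Lp ℝ 2 (volume : Measure ℝ)}
    (hf : ∀ j, inner ℝ (hermiteL2 j) f = 0) : f = 0 := by
  set k : ℝ → ℂ := fun x => ((f x * Real.exp (-(x ^ 2 / 2)) : ℝ) : ℂ) with hk
  have h1 : Integrable k := by
    have := integrable_mul_polynomial_mul_gaussian f 1
    simp only [Polynomial.eval_one, one_mul] at this
    exact this.ofReal
  have h2 : MemLp k 2 volume := by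
    refine (Lp.memLp f).of_le h1.aestronglyMeasurable (Eventually.of_forall fun x => ?_)
    simp only [hk]
    rw [Complex.norm_real, norm_mul]
    refine mul_le_of_le_one_right (norm_nonneg _) ?_
    rw [Real.norm_eq_abs, Real.abs_exp]
    exact Real.exp_le_one_iff.2 (by have := sq_nonneg x; linarith)
  have h3 : ∀ ξ, 𝓕 k ξ = 0 := by
    intro ξ
    -- This `s` satisfies `s √2 x = -2π ξ x`.
    rw [Real.fourier_eq', ← integral_mul_gaussian_mul_cexp_eq_zero hf (-2 * Real.pi * ξ / √2)]
    refine integral_congr_ae (Eventually.of_forall fun x => ?_)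
    simp only [smul_eq_mul, hk]
    congr 2
    have : (√2 : ℂ) ≠ 0 := by exact_mod_cast (by positivity : √2 ≠ 0)
    simp only [RCLike.inner_apply, conj_trivial]
    push_cast
    field_simp
  have h4 : (𝓕 (h2.toLp k) : L2R) = 0 := by
    refine Lp.ext ?_
    filter_upwards [fourier_toLp_ae_eq h1 h2, Lp.coeFn_zero ℂ 2 (volume : Measure ℝ)] with ξ e1 e2
    rw [e1, e2, h3, Pi.zero_apply]
  have h5 : h2.toLp k = 0 := by
    rw [← norm_eq_zero, ← Lp.norm_fourier_eq, h4, norm_zero]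
  refine Lp.ext ?_
  have h6 := h2.coeFn_toLp
  rw [h5] at h6
  filter_upwards [h6, Lp.coeFn_zero ℂ 2 (volume : Measure ℝ),
    Lp.coeFn_zero ℝ 2 (volume : Measure ℝ)] with x e1 e2 e3
  rw [e2, Pi.zero_apply, hk] at e1
  simp only at e1
  rw [e3, Pi.zero_apply]
  have e4 := Complex.ofReal_eq_zero.1 e1.symm
  exact (mul_eq_zero.1 e4).resolve_right (Real.exp_pos _).ne'

/-- The Hilbert basis of Hermite functions. -/
def hermiteBasis : HilbertBasis ℕ ℝ (Lp ℝ 2 (volume : Measure ℝ)) :=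
  HilbertBasis.mkOfOrthogonalEqBot orthonormal_hermiteL2 (by
    rw [Submodule.eq_bot_iff]
    intro f hf
    refine eq_zero_of_inner_hermiteL2_eq_zero fun j => ?_
    exact (Submodule.mem_orthogonal _ _).1 hf _ (Submodule.subset_span ⟨j, rfl⟩))

theorem hermiteBasis_apply (j : ℕ) : hermiteBasis j = hermiteL2 j := by
  rw [hermiteBasis, HilbertBasis.coe_mkOfOrthogonalEqBot]

/-! ### Orthogonality of the chaos polynomials -/

theorem coeFn_finsetSum_smul {Ω ι : Type*} {mΩ : MeasurableSpace Ω} {μ : Measure Ω}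
    (s : Finset ι) (a : ι → ℂ) (F : ι → Lp ℂ 2 μ)
    (f : ι → Ω → ℂ) (h : ∀ i, F i =ᵐ[μ] f i) :
    (∑ i ∈ s, a i • F i : Lp ℂ 2 μ) =ᵐ[μ] fun ω => ∑ i ∈ s, a i * f i ω := by
  have h2 : ∀ᵐ ω ∂μ, ∀ i ∈ s, (a i • F i : Lp ℂ 2 μ) ω = a i * f i ω := by
    rw [Finset.eventually_all]
    intro i _
    filter_upwards [Lp.coeFn_smul (a i) (F i), h i] with ω e1 e2
    rw [e1, Pi.smul_apply, e2, smul_eq_mul]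
  filter_upwards [h2, Lp.coeFn_finsetSum s fun i => a i • F i] with ω e1 e3
  rw [e3, Finset.sum_apply]
  exact Finset.sum_congr rfl e1

section Chaos

variable (P : Measure Omega) [IsWhiteNoise P]

theorem map_eval_hermiteFun (k : ℕ) :
    P.map (fun ω : Omega => ω (hermiteFun k)) = ProbabilityTheory.gaussianReal 0 1 := by
  have h : ‖(hermiteFun k).toLp 2 (volume : Measure ℝ)‖₊ = 1 := by
    ext
    exact orthonormal_hermiteL2.1 k
  rw [map_eval, h, one_pow]

/-- Orthonormality gives `‖∑ t_k h_k‖² = ∑ t_k²`, so the joint characteristic function factorises.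
-/
theorem iIndepFun_eval_hermiteFun (s : Finset ℕ) :
    ProbabilityTheory.iIndepFun (fun (k : s) (ω : Omega) => ω (hermiteFun k)) P := by
  rw [ProbabilityTheory.iIndepFun_iff_charFun_pi fun k => (measurable_eval _).aemeasurable]
  intro t
  have h1 : ∀ k : s, charFun (P.map fun ω : Omega => ω (hermiteFun k)) (t k)
      = Complex.exp (-(t k : ℂ) ^ 2 / 2) := by
    intro k
    rw [map_eval_hermiteFun, ProbabilityTheory.charFun_gaussianReal]
    congr 1
    simp
    ring
  simp only [h1]
  rw [← Complex.exp_sum, charFun_apply,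
    integral_map (Measurable.aemeasurable (by
      refine (WithLp.measurable_toLp 2 _).comp (measurable_pi_lambda _ fun k => ?_)
      exact measurable_eval _)) (by fun_prop)]
  have h2 := IsWhiteNoise.integral_exp (P := P) (∑ k : s, t k • hermiteFun k)
  have h3 : (∑ k : s, t k • hermiteFun k).toLp 2 (volume : Measure ℝ)
      = ∑ k : s, t k • hermiteL2 k := by
    have := map_sum (SchwartzMap.toLpCLM ℝ ℝ 2 (volume : Measure ℝ))
      (fun k : s => t k • hermiteFun k) Finset.univ
    simp only [map_smul] at this
    exact this
  have h4 : ‖∑ k : s, t k • hermiteL2 k‖ ^ 2 = ∑ k : s, t k ^ 2 := by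
    have ho : Orthonormal ℝ fun k : s => hermiteL2 k :=
      orthonormal_hermiteL2.comp _ Subtype.val_injective
    rw [← real_inner_self_eq_norm_sq, ho.inner_sum]
    simp [sq]
  rw [h3, h4] at h2
  have h5 : ∀ ω : Omega, (inner ℝ (WithLp.toLp 2 fun k : s => ω (hermiteFun k)) t : ℝ)
      = ω (∑ k : s, t k • hermiteFun k) := by
    intro ω
    rw [map_sum, PiLp.inner_apply]
    simp
  simp only [h5, mul_comm _ Complex.I]
  rw [h2]
  congr 1
  push_cast
  rw [← Finset.sum_neg_distrib, Finset.sum_div]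

theorem integrable_prod_polynomial (s : Finset ℕ) (p : ℕ → Polynomial ℝ) :
    Integrable (fun ω : Omega => ∏ k ∈ s, (p k).eval (ω (hermiteFun k))) P := by
  have hX := (iIndepFun_eval_hermiteFun P s).map_fun_eq_pi_map
    fun k => (measurable_eval _).aemeasurable
  have hm : Measurable fun (ω : Omega) (k : s) => ω (hermiteFun k) :=
    measurable_pi_lambda _ fun k => measurable_eval _
  have h : Integrable (fun x : s → ℝ => ∏ k : s, (p k).eval (x k))
      (P.map fun (ω : Omega) (k : s) => ω (hermiteFun k)) := by
    rw [hX]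
    refine Integrable.fintype_prod (f := fun (k : s) (y : ℝ) => (p k).eval y) fun k => ?_
    rw [map_eval_hermiteFun]
    exact integrable_gaussianReal_polynomial _
  have h2 := h.comp_measurable hm
  refine h2.congr (Eventually.of_forall fun ω => ?_)
  exact Finset.prod_coe_sort s fun k => (p k).eval (ω (hermiteFun k))

theorem integral_prod_polynomial (s : Finset ℕ) (p : ℕ → Polynomial ℝ) :
    ∫ ω : Omega, ∏ k ∈ s, (p k).eval (ω (hermiteFun k)) ∂P
      = ∏ k ∈ s, ∫ y, (p k).eval y ∂(ProbabilityTheory.gaussianReal 0 1) := by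
  have h := (iIndepFun_eval_hermiteFun P s).integral_fun_prod_comp
    (f := fun (k : s) (y : ℝ) => (p k).eval y) (fun k => (measurable_eval _).aemeasurable)
    (fun k => by fun_prop)
  have h2 : ∀ ω : Omega, ∏ k : s, (p k).eval (ω (hermiteFun k))
      = ∏ k ∈ s, (p k).eval (ω (hermiteFun k)) := fun ω =>
    Finset.prod_coe_sort s fun k => (p k).eval (ω (hermiteFun k))
  simp only [h2] at h
  rw [h, Finset.prod_coe_sort s fun k => ∫ ω : Omega, (p k).eval (ω (hermiteFun k)) ∂P]
  refine Finset.prod_congr rfl fun k _ => ?_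
  rw [← map_eval_hermiteFun P k, integral_map (measurable_eval _).aemeasurable (by fun_prop)]

end Chaos

/-- Extra indices contribute only `h_0 = 1`, so two multi-indices can be compared over one common
set. -/
theorem chaosH_eq_prod {α : MultiIndex} {s : Finset ℕ} (hs : α.support ⊆ s) (ω : Omega) :
    chaosH α ω = ∏ k ∈ s, (hermiteReal (α k)).eval (ω (hermiteFun k)) := by
  rw [chaosH, Finsupp.prod_of_support_subset _ hs _ (by simp)]
  simp only [eval_hermiteReal]

section Chaos

variable (P : Measure Omega) [IsWhiteNoise P]

theorem memLp_chaosH (α : MultiIndex) : MemLp (fun ω => (chaosH α ω : ℂ)) 2 P := by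
  have h1 : Integrable (chaosH α) P := by
    refine (integrable_prod_polynomial P α.support fun k => hermiteReal (α k)).congr
      (Eventually.of_forall fun ω => (chaosH_eq_prod subset_rfl ω).symm)
  have h2 : MemLp (chaosH α) 2 P := by
    rw [memLp_two_iff_integrable_sq h1.aestronglyMeasurable]
    refine (integrable_prod_polynomial P α.support fun k => hermiteReal (α k) ^ 2).congr
      (Eventually.of_forall fun ω => ?_)
    simp only
    rw [chaosH_eq_prod subset_rfl ω, ← Finset.prod_pow]
    simp
  exact h2.ofReal

/-- `H_α` as an element of `L²(Ω, P)`. -/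
def chaosLp (α : MultiIndex) : Lp ℂ 2 P := (memLp_chaosH P α).toLp _

/-- `α! = ∏_k α_k!`. -/
def multiFact (α : MultiIndex) : ℝ := α.prod fun _ j => (j ! : ℝ)

theorem one_le_multiFact (α : MultiIndex) : 1 ≤ multiFact α :=
  Finset.one_le_prod fun k _ => Nat.one_le_cast.2 (Nat.factorial_pos (α k))

/-- Independence factorises the integral. A coordinate where `α` and `β` differ gives a factor zero.
-/
theorem inner_chaosLp (α β : MultiIndex) :
    inner ℂ (chaosLp P α) (chaosLp P β) = if α = β then (multiFact α : ℂ) else 0 := by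
  classical
  set s := α.support ∪ β.support with hs
  have hα : α.support ⊆ s := Finset.subset_union_left
  have hβ : β.support ⊆ s := Finset.subset_union_right
  have h1 : inner ℂ (chaosLp P α) (chaosLp P β)
      = ((∫ ω : Omega, ∏ k ∈ s, (hermiteReal (α k) * hermiteReal (β k)).eval (ω (hermiteFun k)) ∂P
        : ℝ) : ℂ) := by
    rw [L2.inner_def, ← integral_complex_ofReal]
    refine integral_congr_ae ?_
    filter_upwards [(memLp_chaosH P α).coeFn_toLp, (memLp_chaosH P β).coeFn_toLp] with ω e1 e2
    rw [chaosLp, chaosLp, e1, e2, chaosH_eq_prod hα, chaosH_eq_prod hβ]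
    simp only [Polynomial.eval_mul, Finset.prod_mul_distrib, RCLike.inner_apply,
      Complex.conj_ofReal]
    push_cast
    ring
  rw [h1, integral_prod_polynomial]
  simp only [Polynomial.eval_mul, integral_gaussianReal_hermite_mul_hermite]
  split_ifs with h
  · subst h
    rw [multiFact, Finsupp.prod_of_support_subset _ hα _ (by simp)]
    simp
  · obtain ⟨k, hk⟩ := Finsupp.ne_iff.1 h
    have hks : k ∈ s := by
      rw [hs, Finset.mem_union, Finsupp.mem_support_iff, Finsupp.mem_support_iff]
      by_contra hcon
      push Not at hcon
      exact hk (hcon.1.trans hcon.2.symm)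
    rw [Finset.prod_eq_zero hks (by rw [if_neg hk])]
    simp

/-- Partial sums of classes represent the pointwise partial sums, so the definition becomes a
`HasSum` open to Hilbert space arguments. -/
theorem hasChaosExpansion_iff (a : MultiIndex → ℂ) (F : Omega → ℂ) :
    HasChaosExpansion P a F ↔
      ∃ hF : MemLp F 2 P, HasSum (fun α => a α • chaosLp P α) (hF.toLp F) := by
  have key : ∀ (hF : MemLp F 2 P) (s : Finset MultiIndex),
      edist (∑ α ∈ s, a α • chaosLp P α) (hF.toLp F)
        = eLpNorm (fun ω => F ω - ∑ α ∈ s, a α * (chaosH α ω : ℂ)) 2 P := by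
    intro hF s
    have hS : MemLp (fun ω => ∑ α ∈ s, a α * (chaosH α ω : ℂ)) 2 P :=
      memLp_finsetSum _ fun α _ => (memLp_chaosH P α).const_mul (a α)
    have h1 : ∑ α ∈ s, a α • chaosLp P α = hS.toLp _ := by
      refine Lp.ext (EventuallyEq.trans ?_ hS.coeFn_toLp.symm)
      exact coeFn_finsetSum_smul _ _ _ _ fun α => (memLp_chaosH P α).coeFn_toLp
    rw [h1, edist_comm, Lp.edist_toLp_toLp]
    rfl
  constructor
  · rintro ⟨hF, h⟩
    refine ⟨hF, ?_⟩
    rw [HasSum, SummationFilter.unconditional_filter, tendsto_iff_edist_tendsto_0]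
    simpa only [key hF] using h
  · rintro ⟨hF, h⟩
    refine ⟨hF, ?_⟩
    rw [HasSum, SummationFilter.unconditional_filter, tendsto_iff_edist_tendsto_0] at h
    simpa only [key hF] using h

theorem HasChaosExpansion.coeff_eq {a : MultiIndex → ℂ} {F : Omega → ℂ}
    (h : HasChaosExpansion P a F) (hF : MemLp F 2 P) (β : MultiIndex) :
    a β * multiFact β = inner ℂ (chaosLp P β) (hF.toLp F) := by
  obtain ⟨hF', hs⟩ := (hasChaosExpansion_iff P a F).1 h
  have h1 := hs.mapL (innerSL ℂ (chaosLp P β))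
  simp only [innerSL_apply_apply, inner_smul_right, inner_chaosLp] at h1
  have h2 := hasSum_single β (f := fun α => a α * (if β = α then (multiFact β : ℂ) else 0))
    (fun α hα => by rw [if_neg (Ne.symm hα), mul_zero])
  rw [if_pos rfl] at h2
  exact h2.unique h1

/-- The coefficients of a chaos expansion are unique. -/
theorem HasChaosExpansion.unique {a b : MultiIndex → ℂ} {F : Omega → ℂ}
    (ha : HasChaosExpansion P a F) (hb : HasChaosExpansion P b F) : a = b := by
  funext β
  have h : (multiFact β : ℂ) ≠ 0 := by
    exact_mod_cast (zero_lt_one.trans_le (one_le_multiFact β)).ne'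
  exact mul_right_cancel₀ h ((ha.coeff_eq P ha.1 β).trans (hb.coeff_eq P ha.1 β).symm)

end Chaos

theorem HasChaosExpansion.congr {P : Measure Omega} {a : MultiIndex → ℂ} {F G : Omega → ℂ}
    (h : HasChaosExpansion P a F) (hFG : F =ᵐ[P] G) : HasChaosExpansion P a G := by
  refine ⟨(memLp_congr_ae hFG).1 h.1, ?_⟩
  refine h.2.congr fun s => eLpNorm_congr_ae ?_
  filter_upwards [hFG] with ω e
  rw [e]

/-! ### Wick powers of elements of the first chaos -/

/-- The coefficients `n! g^α / α!`, `|α| = n`, of the `n`-th Wick power of `∑_k g_k H_{ε_k}`. -/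
def wickMonomial (g : ℕ → ℂ) (n : ℕ) (α : MultiIndex) : ℂ :=
  if α.degree = n then n ! * α.prod fun k j => g k ^ j / (j ! : ℂ) else 0

theorem wickMonomial_of_degree_ne {g : ℕ → ℂ} {n : ℕ} {α : MultiIndex} (h : α.degree ≠ n) :
    wickMonomial g n α = 0 := if_neg h

theorem wickMonomial_zero (g : ℕ → ℂ) :
    wickMonomial g 0 = fun α => if α = 0 then 1 else 0 := by
  funext α
  rw [wickMonomial]
  by_cases h : α = 0
  · simp [h]
  · rw [if_neg h, if_neg]
    rwa [Finsupp.degree_eq_zero_iff]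

theorem exists_single_of_degree_eq_one {α : MultiIndex} (h : α.degree = 1) :
    ∃ k, α = Finsupp.single k 1 := by
  have h0 : α ≠ 0 := by
    rintro rfl
    simp at h
  obtain ⟨k, hk⟩ := Finsupp.support_nonempty_iff.2 h0
  have hle : Finsupp.single k 1 ≤ α := by
    rw [Finsupp.single_le_iff]
    exact Nat.one_le_iff_ne_zero.2 (Finsupp.mem_support_iff.1 hk)
  have h1 := tsub_add_cancel_of_le hle
  have h2 := congrArg Finsupp.degree h1
  rw [map_add, h, Finsupp.degree_single] at h2
  have h3 : α - Finsupp.single k 1 = 0 := by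
    rw [← Finsupp.degree_eq_zero_iff]
    omega
  rw [h3, zero_add] at h1
  exact ⟨k, h1.symm⟩

theorem wickMonomial_one_single (g : ℕ → ℂ) (k : ℕ) :
    wickMonomial g 1 (Finsupp.single k 1) = g k := by
  rw [wickMonomial, if_pos (by simp), Finsupp.prod_single_index (by simp)]
  simp

/-- Only the factor at `k` changes, where `1 / j! = (j + 1) / (j + 1)!`. -/
theorem prod_sub_single_mul (g : ℕ → ℂ) {γ : MultiIndex} {k : ℕ} (hk : k ∈ γ.support) :
    ((γ - Finsupp.single k 1).prod fun k j => g k ^ j / (j ! : ℂ)) * g k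
      = γ k * γ.prod fun k j => g k ^ j / (j ! : ℂ) := by
  have h1 := Finsupp.mul_prod_erase' (γ - Finsupp.single k 1) k
    (fun k j => g k ^ j / (j ! : ℂ)) (by simp)
  have h2 := Finsupp.mul_prod_erase γ k (fun k j => g k ^ j / (j ! : ℂ)) hk
  have h3 : (γ - Finsupp.single k 1).erase k = γ.erase k := by
    ext i
    by_cases hi : i = k
    · subst hi
      simp
    · rw [Finsupp.erase_ne hi, Finsupp.erase_ne hi, Finsupp.tsub_apply,
        Finsupp.single_eq_of_ne hi, tsub_zero]
  obtain ⟨j, hj⟩ := Nat.exists_eq_succ_of_ne_zero (Finsupp.mem_support_iff.1 hk)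
  rw [← h1, ← h2, h3]
  simp only [Finsupp.tsub_apply, Finsupp.single_eq_same, hj, Nat.succ_eq_add_one,
    Nat.add_sub_cancel, Nat.factorial_succ]
  have e1 : (j ! : ℂ) ≠ 0 := by exact_mod_cast j.factorial_ne_zero
  have e2 : ((j : ℂ) + 1) ≠ 0 := by exact_mod_cast j.succ_ne_zero
  push_cast
  field_simp
  ring

/-- Only the splittings `γ = (γ - ε_k) + ε_k` contribute, each with weight `γ_k`. The weights add up
to `|γ| = n + 1`, which turns `n!` into `(n + 1)!`. -/
theorem wickCoeff_wickMonomial (g : ℕ → ℂ) (n : ℕ) :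
    wickCoeff (wickMonomial g n) (wickMonomial g 1) = wickMonomial g (n + 1) := by
  funext γ
  rw [wickCoeff]
  by_cases hγ : γ.degree = n + 1
  · have h1 : ∑ k ∈ γ.support, (n ! : ℂ) * (γ k * γ.prod fun k j => g k ^ j / (j ! : ℂ))
        = ∑ x ∈ Finset.HasAntidiagonal.antidiagonal γ,
          wickMonomial g n x.1 * wickMonomial g 1 x.2 := by
      have hle : ∀ k ∈ γ.support, Finsupp.single k 1 ≤ γ := by
        intro k hk
        rw [Finsupp.single_le_iff]
        exact Nat.one_le_iff_ne_zero.2 (Finsupp.mem_support_iff.1 hk)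
      refine Finset.sum_of_injOn (fun k => (γ - Finsupp.single k 1, Finsupp.single k 1)) ?_ ?_ ?_ ?_
      · intro k _ l _ h
        have h2 := congrArg Prod.snd h
        exact Finsupp.single_left_injective one_ne_zero h2
      · intro k hk
        rw [Finset.mem_coe, Finset.HasAntidiagonal.mem_antidiagonal]
        exact tsub_add_cancel_of_le (hle k hk)
      · rintro ⟨α, β⟩ hx hnot
        rw [Finset.HasAntidiagonal.mem_antidiagonal] at hx
        simp only at hx ⊢
        rw [wickMonomial_of_degree_ne (α := β), mul_zero]
        intro hβ
        obtain ⟨k, rfl⟩ := exists_single_of_degree_eq_one hβ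
        refine hnot ⟨k, ?_, ?_⟩
        · rw [Finset.mem_coe, Finsupp.mem_support_iff, ← hx]
          simp
        · simp only [← hx, add_tsub_cancel_right]
      · intro k hk
        have hd : (γ - Finsupp.single k 1).degree = n := by
          have h3 := congrArg Finsupp.degree (tsub_add_cancel_of_le (hle k hk))
          rw [map_add, hγ, Finsupp.degree_single] at h3
          omega
        simp only
        rw [wickMonomial_one_single, wickMonomial, if_pos hd, mul_assoc, prod_sub_single_mul g hk]
    rw [← h1, ← Finset.mul_sum, ← Finset.sum_mul, wickMonomial, if_pos hγ, Nat.factorial_succ]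
    have h2 : ∑ k ∈ γ.support, (γ k : ℂ) = n + 1 := by
      have : ((γ.degree : ℕ) : ℂ) = n + 1 := by
        rw [hγ]
        push_cast
        rfl
      rw [← this, Finsupp.degree_apply]
      push_cast
      rfl
    rw [h2]
    push_cast
    ring
  · rw [wickMonomial_of_degree_ne hγ]
    refine Finset.sum_eq_zero fun x hx => ?_
    rw [Finset.HasAntidiagonal.mem_antidiagonal] at hx
    by_cases h1 : x.1.degree = n
    · rw [wickMonomial_of_degree_ne (α := x.2), mul_zero]
      intro h2
      apply hγ
      rw [← hx, map_add, h1, h2]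
    · rw [wickMonomial_of_degree_ne h1, zero_mul]

theorem wickPow_eq_wickMonomial {g : ℕ → ℂ} {Φ : Kondratiev} (h : Φ.1 = wickMonomial g 1)
    (n : ℕ) : (Φ.wickPow n).1 = wickMonomial g n := by
  induction n with
  | zero => exact (wickMonomial_zero g).symm
  | succ n ih =>
    change wickCoeff (Φ.wickPow n).1 Φ.1 = _
    rw [ih, h, wickCoeff_wickMonomial]

/-! ### Square summability of the Wick power coefficients. -/

theorem summable_wickMonomial {g : ℕ → ℂ} (hg : Summable g) (n : ℕ) :
    Summable (wickMonomial g n) := by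
  have h1 : Summable (wickMonomial g 1) := by
    have hinj : Function.Injective fun k : ℕ => (Finsupp.single k 1 : MultiIndex) :=
      Finsupp.single_left_injective one_ne_zero
    refine (hinj.summable_iff ?_).1 ?_
    · intro α hα
      refine wickMonomial_of_degree_ne fun hd => hα ?_
      obtain ⟨k, rfl⟩ := exists_single_of_degree_eq_one hd
      exact ⟨k, rfl⟩
    · refine hg.congr fun k => ?_
      exact (wickMonomial_one_single g k).symm
  induction n with
  | zero =>
    rw [wickMonomial_zero]
    exact summable_of_ne_finset_zero (s := {0}) fun α hα => if_neg (by simpa using hα)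
  | succ n ih =>
    rw [← wickCoeff_wickMonomial]
    -- The next family is a convolution of two absolutely summable ones.
    exact summable_sum_mul_antidiagonal_of_summable_mul
      (summable_mul_of_summable_norm ih.norm h1.norm)

/-- One of the two factors `1 / α!` in the square cancels. The left side is the contribution of `α`
to the squared `L²` norm, which is thereby reduced to a plain sum for the sequence `|g_k|²`. -/
theorem norm_sq_wickMonomial_mul_multiFact (g : ℕ → ℂ) (n : ℕ) (α : MultiIndex) :
    ((‖wickMonomial g n α‖ ^ 2 * multiFact α : ℝ) : ℂ)
      = n ! * wickMonomial (fun k => ((‖g k‖ ^ 2 : ℝ) : ℂ)) n α := by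
  rw [wickMonomial, wickMonomial]
  split_ifs with h
  · rw [multiFact, norm_mul, Finsupp.prod, Finsupp.prod, Finsupp.prod, norm_prod, mul_pow,
      ← Finset.prod_pow, mul_assoc, ← Finset.prod_mul_distrib]
    push_cast
    rw [← mul_assoc, Complex.norm_natCast, Complex.ofReal_natCast, sq]
    congr 1
    refine Finset.prod_congr rfl fun k _ => ?_
    have e1 : ((α k)! : ℂ) ≠ 0 := by exact_mod_cast (α k).factorial_ne_zero
    rw [norm_div, norm_pow, Complex.norm_natCast]
    push_cast
    field_simp
    rw [← pow_mul, ← pow_mul, mul_comm]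
  · simp

theorem summable_norm_sq_wickMonomial {g : ℕ → ℂ} (hg : Summable fun k => ‖g k‖ ^ 2) (n : ℕ) :
    Summable fun α => ‖wickMonomial g n α‖ ^ 2 * multiFact α := by
  rw [← Complex.summable_ofReal]
  simp only [norm_sq_wickMonomial_mul_multiFact]
  exact (summable_wickMonomial (Complex.summable_ofReal.2 hg) n).mul_left _

theorem isKondratiev_wickMonomial {g : ℕ → ℂ} (hg : Summable fun k => ‖g k‖ ^ 2) (n : ℕ) :
    IsKondratiev (wickMonomial g n) := by
  -- The exponent `q = 1` suffices because `(2ℕ)^{-α} ≤ 1 ≤ α!`.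
  refine ⟨1, le_rfl, Summable.of_nonneg_of_le (fun α => ?_) (fun α => ?_)
    (summable_norm_sq_wickMonomial hg n)⟩
  · have := one_le_twoNPow α
    positivity
  · refine mul_le_mul_of_nonneg_left ?_ (by positivity)
    rw [pow_one]
    exact (inv_le_one_of_one_le₀ (one_le_twoNPow α)).trans (one_le_multiFact α)

theorem summable_wickMonomial_smul_chaosLp (P : Measure Omega) [IsWhiteNoise P] {g : ℕ → ℂ}
    (hg : Summable fun k => ‖g k‖ ^ 2) (n : ℕ) :
    Summable fun α => wickMonomial g n α • chaosLp P α := by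
  classical
  have hpos : ∀ α, 0 < multiFact α := fun α => zero_lt_one.trans_le (one_le_multiFact α)
  -- After normalising by `√(α!)`, convergence is equivalent to square summability of the
  -- coefficients times `√(α!)`.
  have hon : Orthonormal ℂ fun α => ((√(multiFact α))⁻¹ : ℂ) • chaosLp P α := by
    rw [orthonormal_iff_ite]
    intro α β
    rw [inner_smul_left, inner_smul_right, inner_chaosLp]
    split_ifs with h
    · subst h
      rw [← Complex.ofReal_inv, Complex.conj_ofReal, ← Complex.ofReal_mul, ← Complex.ofReal_mul,
        ← Complex.ofReal_one]
      congr 1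
      have h1 : √(multiFact α) ≠ 0 := (Real.sqrt_pos.2 (hpos α)).ne'
      field_simp
      rw [Real.sq_sqrt (hpos α).le]
    · simp
  have h := (hon.orthogonalFamily.summable_iff_norm_sq_summable
    fun α => wickMonomial g n α * (√(multiFact α) : ℂ)).2 ?_
  · refine h.congr fun α => ?_
    have h1 : (√(multiFact α) : ℂ) ≠ 0 := by
      exact_mod_cast (Real.sqrt_pos.2 (hpos α)).ne'
    rw [LinearIsometry.toSpanSingleton_apply, smul_smul, mul_assoc, mul_inv_cancel₀ h1, mul_one]
  · refine (summable_norm_sq_wickMonomial hg n).congr fun α => ?_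
    rw [norm_mul, Complex.norm_real, mul_pow, Real.norm_eq_abs, sq_abs, Real.sq_sqrt (hpos α).le]

/-! ### The chaos expansion of `Q_g` and of its Wick powers -/

/-- The coordinates of `g ∈ L²(ℝ)` with respect to the Hermite functions. -/
def hermiteCoord (g : L2R) (k : ℕ) : ℂ :=
  ((inner ℝ (hermiteL2 k) (Complex.reCLM.compLp g) : ℝ) : ℂ)
    + Complex.I * ((inner ℝ (hermiteL2 k) (Complex.imCLM.compLp g) : ℝ) : ℂ)

theorem hasSum_inner_hermiteL2_mul (u v : Lp ℝ 2 (volume : Measure ℝ)) :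
    HasSum (fun k => inner ℝ (hermiteL2 k) u * inner ℝ (hermiteL2 k) v) (inner ℝ u v) := by
  refine (hermiteBasis.hasSum_inner_mul_inner u v).congr_fun fun k => ?_
  rw [hermiteBasis_apply, real_inner_comm u]

theorem summable_norm_sq_hermiteCoord (g : L2R) : Summable fun k => ‖hermiteCoord g k‖ ^ 2 := by
  refine ((hasSum_inner_hermiteL2_mul (Complex.reCLM.compLp g) (Complex.reCLM.compLp g)).summable.add
    (hasSum_inner_hermiteL2_mul (Complex.imCLM.compLp g) (Complex.imCLM.compLp g)).summable).congr fun k => ?_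
  rw [← Complex.normSq_eq_norm_sq, hermiteCoord, mul_comm Complex.I, Complex.normSq_add_mul_I,
    sq, sq]

/-- Parseval for the real pairs `(u, u)`, `(v, v)`, `(u, v)`, combined through `(a + ib)² = a² - b²
+ 2iab`. No conjugate enters, hence `∫ g²` and not `‖g‖²`. -/
theorem hasSum_hermiteCoord_sq (g : L2R) :
    HasSum (fun k => hermiteCoord g k ^ 2) (∫ x, (g x) ^ 2) := by
  set u : Lp ℝ 2 (volume : Measure ℝ) := Complex.reCLM.compLp g with hu
  set v : Lp ℝ 2 (volume : Measure ℝ) := Complex.imCLM.compLp g with hv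
  have hint : ∀ a b : Lp ℝ 2 (volume : Measure ℝ), Integrable fun x => a x * b x := fun a b =>
    (Lp.memLp a).integrable_mul (Lp.memLp b)
  have hinner : ∀ a b : Lp ℝ 2 (volume : Measure ℝ),
      ((inner ℝ a b : ℝ) : ℂ) = ∫ x, ((a x * b x : ℝ) : ℂ) := by
    intro a b
    rw [L2.inner_def, integral_complex_ofReal]
    congr 1
    refine integral_congr_ae (Eventually.of_forall fun x => ?_)
    simp [mul_comm]
  have h1 : ∫ x, (g x) ^ 2 = ((inner ℝ u u : ℝ) : ℂ) - ((inner ℝ v v : ℝ) : ℂ)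
      + 2 * Complex.I * ((inner ℝ u v : ℝ) : ℂ) := by
    have hsub : Integrable fun x => ((u x * u x : ℝ) : ℂ) - ((v x * v x : ℝ) : ℂ) :=
      (hint u u).ofReal.sub (hint v v).ofReal
    have hmul : Integrable fun x => 2 * Complex.I * ((u x * v x : ℝ) : ℂ) :=
      (hint u v).ofReal.const_mul (2 * Complex.I)
    rw [hinner, hinner, hinner, ← integral_const_mul,
      ← integral_sub (hint u u).ofReal (hint v v).ofReal, ← integral_add hsub hmul]
    refine integral_congr_ae ?_
    filter_upwards [Complex.reCLM.coeFn_compLp g, Complex.imCLM.coeFn_compLp g] with x e1 e2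
    rw [hu, hv, e1, e2]
    simp only [Complex.reCLM_apply, Complex.imCLM_apply]
    conv_lhs => rw [← Complex.re_add_im (g x)]
    push_cast
    ring_nf
    rw [Complex.I_sq]
    ring
  rw [h1]
  have huu := Complex.hasSum_ofReal.2 (hasSum_inner_hermiteL2_mul u u)
  have hvv := Complex.hasSum_ofReal.2 (hasSum_inner_hermiteL2_mul v v)
  have huv := (Complex.hasSum_ofReal.2 (hasSum_inner_hermiteL2_mul u v)).mul_left (2 * Complex.I)
  refine ((huu.sub hvv).add huv).congr_fun fun k => ?_
  rw [hermiteCoord]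
  push_cast
  ring_nf
  rw [Complex.I_sq]
  ring

section Expansion

variable (P : Measure Omega) [IsWhiteNoise P]

/-- `ω ↦ ⟨ω, hermiteFun k⟩` in the complex space `L²(Ω, P)`. -/
def evalHermite (k : ℕ) : Lp ℂ 2 P := Complex.ofRealCLM.compLp (evalLin P (hermiteFun k))

theorem evalHermite_ae (k : ℕ) :
    evalHermite P k =ᵐ[P] fun ω => ((ω (hermiteFun k) : ℝ) : ℂ) := by
  filter_upwards [Complex.ofRealCLM.coeFn_compLp (evalLin P (hermiteFun k)),
    (memLp_eval P (hermiteFun k)).coeFn_toLp] with ω e1 e2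
  rw [evalHermite, e1, Complex.ofRealCLM_apply]
  congr 1

/-- Continuous linear maps carry the Hermite expansion of `u` along, and `QReal` sends Hermite
functions to evaluations. -/
theorem hasSum_ofReal_QReal (u : Lp ℝ 2 (volume : Measure ℝ)) :
    HasSum (fun k => ((inner ℝ (hermiteL2 k) u : ℝ) : ℂ) • evalHermite P k)
      (Complex.ofRealCLM.compLp (QReal P u)) := by
  have h := ((hermiteBasis.hasSum_repr u).mapL (QReal P)).mapL
    (ContinuousLinearMap.compLpL 2 P Complex.ofRealCLM)
  refine h.congr_fun fun k => ?_
  rw [map_smul, map_smul, hermiteBasis.repr_apply_apply, hermiteBasis_apply, hermiteL2, QReal_toLp]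
  exact (RCLike.real_smul_eq_coe_smul (K := ℂ) _ _).symm

theorem hasSum_Q (g : L2R) :
    HasSum (fun k => hermiteCoord g k • evalHermite P k) (Q P g) := by
  have h := (hasSum_ofReal_QReal P (Complex.reCLM.compLp g)).add
    ((hasSum_ofReal_QReal P (Complex.imCLM.compLp g)).const_smul Complex.I)
  refine h.congr_fun fun k => ?_
  rw [hermiteCoord, add_smul, mul_smul]

theorem wickMonomial_mul_chaosH {N n : ℕ} {α : MultiIndex}
    (hα : α ∈ (Finset.range N).finsuppAntidiag n) (g : ℕ → ℂ) (ω : Omega) :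
    wickMonomial g n α * (chaosH α ω : ℂ) = n ! * ∏ k ∈ Finset.range N,
      (g k ^ α k * ((Polynomial.aeval (ω (hermiteFun k)) (Polynomial.hermite (α k)) : ℝ) : ℂ)
        / (α k)!) := by
  rw [Finset.mem_finsuppAntidiag] at hα
  have hd : α.degree = n := by
    rw [← hα.1, Finsupp.degree_apply]
    exact Finset.sum_subset hα.2 fun k _ hk => Finsupp.notMem_support_iff.1 hk
  rw [wickMonomial, if_pos hd, chaosH_eq_prod hα.2, Finsupp.prod_of_support_subset _ hα.2 _ (by simp),
    mul_assoc]
  push_cast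
  rw [← Finset.prod_mul_distrib]
  congr 1
  refine Finset.prod_congr rfl fun k _ => ?_
  rw [eval_hermiteReal]
  ring

/-- The multi-indices of degree at most `N` supported in `{0, …, N - 1}`. -/
def boxIndices (N : ℕ) : Finset MultiIndex :=
  (Finset.range (N + 1)).biUnion fun j => (Finset.range N).finsuppAntidiag j

theorem mem_boxIndices {N : ℕ} {α : MultiIndex} :
    α ∈ boxIndices N ↔ α.degree ≤ N ∧ α.support ⊆ Finset.range N := by
  simp only [boxIndices, Finset.mem_biUnion, Finset.mem_range, Finset.mem_finsuppAntidiag]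
  have key : ∀ h : α.support ⊆ Finset.range N, (Finset.range N).sum α = α.degree := by
    intro h
    rw [Finsupp.degree_apply]
    exact (Finset.sum_subset h fun k _ hk => Finsupp.notMem_support_iff.1 hk).symm
  constructor
  · rintro ⟨j, hj, h1, h2⟩
    rw [key h2] at h1
    exact ⟨by omega, h2⟩
  · rintro ⟨h1, h2⟩
    exact ⟨α.degree, by omega, key h2, h2⟩

/-- Cofinality replaces the unconditional sum by a sequence, from which a.e. convergent subsequences
can be extracted. -/
theorem tendsto_boxIndices : Tendsto boxIndices atTop atTop := by
  refine tendsto_atTop_finset_of_monotone ?_ ?_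
  · intro N M hNM α hα
    rw [mem_boxIndices] at hα ⊢
    exact ⟨hα.1.trans hNM, hα.2.trans (Finset.range_mono hNM)⟩
  · intro α
    refine ⟨max α.degree (α.support.sup id + 1), mem_boxIndices.2 ⟨le_max_left _ _, ?_⟩⟩
    intro k hk
    rw [Finset.mem_range]
    have : k ≤ α.support.sup id := Finset.le_sup (f := id) hk
    omega

/-- Only the slice of degree `n` contributes, and `n ≤ N` puts it inside the box. The multinomial
theorem for Hermite polynomials evaluates it. -/
theorem sum_boxIndices {N n : ℕ} (hN : n ≤ N) (g : ℕ → ℂ) (ω : Omega) :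
    ∑ α ∈ boxIndices N, wickMonomial g n α * (chaosH α ω : ℂ)
      = wickFormula n (∑ k ∈ Finset.range N, g k ^ 2)
        (∑ k ∈ Finset.range N, g k * ((ω (hermiteFun k) : ℝ) : ℂ)) := by
  have h0 : (n ! : ℂ) ≠ 0 := by exact_mod_cast n.factorial_ne_zero
  have h1 : (Finset.range N).finsuppAntidiag n ⊆ boxIndices N := by
    intro α hα
    exact Finset.mem_biUnion.2 ⟨n, Finset.mem_range.2 (by omega), hα⟩
  rw [← Finset.sum_subset h1, Finset.sum_congr rfl fun α hα => wickMonomial_mul_chaosH hα g ω,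
    ← Finset.mul_sum, sum_finsuppAntidiag_hermite, mul_div_cancel₀ _ h0]
  intro α hα hnot
  rw [wickMonomial_of_degree_ne, zero_mul]
  intro hd
  rw [mem_boxIndices] at hα
  refine hnot (Finset.mem_finsuppAntidiag.2 ⟨?_, hα.2⟩)
  rw [← hd, Finsupp.degree_apply]
  exact (Finset.sum_subset hα.2 fun k _ hk => Finsupp.notMem_support_iff.1 hk).symm

/-- The chaos expansion of the Wick formula. -/
theorem hasChaosExpansion_wickFormula (g : L2R) (n : ℕ) :
    HasChaosExpansion P (wickMonomial (hermiteCoord g) n)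
      (fun ω => wickFormula n (∫ x, (g x) ^ 2) (Q P g ω)) := by
  obtain ⟨S, hS⟩ := summable_wickMonomial_smul_chaosLp P (summable_norm_sq_hermiteCoord g) n
  have hT : Tendsto (fun N => ∑ α ∈ boxIndices N,
      wickMonomial (hermiteCoord g) n α • chaosLp P α) atTop (𝓝 S) := by
    rw [HasSum, SummationFilter.unconditional_filter] at hS
    exact hS.comp tendsto_boxIndices
  have hY := (hasSum_Q P g).tendsto_sum_nat
  have hc := (hasSum_hermiteCoord_sq g).tendsto_sum_nat
  -- The second subsequence refines the first, so `Q_g` and the chaos series converge a.e. along the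
  -- same indices.
  obtain ⟨ns, hns, hYae⟩ := (tendstoInMeasure_of_tendsto_Lp hY).exists_seq_tendsto_ae
  obtain ⟨ms, hms, hTae⟩ := (tendstoInMeasure_of_tendsto_Lp
    (hT.comp hns.tendsto_atTop)).exists_seq_tendsto_ae
  have hYN : ∀ᵐ ω ∂P, ∀ N, (∑ k ∈ Finset.range N, hermiteCoord g k • evalHermite P k : Lp ℂ 2 P) ω
      = ∑ k ∈ Finset.range N, hermiteCoord g k * ((ω (hermiteFun k) : ℝ) : ℂ) :=
    ae_all_iff.2 fun N => coeFn_finsetSum_smul _ _ _ _ (evalHermite_ae P)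
  have hTN : ∀ᵐ ω ∂P, ∀ N, (∑ α ∈ boxIndices N,
      wickMonomial (hermiteCoord g) n α • chaosLp P α : Lp ℂ 2 P) ω
      = ∑ α ∈ boxIndices N, wickMonomial (hermiteCoord g) n α * (chaosH α ω : ℂ) :=
    ae_all_iff.2 fun N => coeFn_finsetSum_smul _ _ _ _
      fun α => (memLp_chaosH P α).coeFn_toLp
  have hSae : S =ᵐ[P] fun ω => wickFormula n (∫ x, (g x) ^ 2) (Q P g ω) := by
    filter_upwards [hYae, hTae, hYN, hTN] with ω h1 h2 h3 h4
    have hidx : Tendsto (ns ∘ ms) atTop atTop := hns.tendsto_atTop.comp hms.tendsto_atTop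
    have h5 := (continuous_wickFormula n).continuousAt.tendsto.comp
      ((hc.comp hidx).prodMk_nhds (h1.comp hms.tendsto_atTop))
    refine tendsto_nhds_unique h2 (h5.congr' ?_)
    filter_upwards [hidx.eventually_ge_atTop n] with j hj
    simp only [Function.comp_apply] at hj ⊢
    rw [h3, h4, sum_boxIndices hj]
  -- Square integrability is inherited from `S`; no moment estimate for powers of `Q_g` is needed.
  have hmem : MemLp (fun ω => wickFormula n (∫ x, (g x) ^ 2) (Q P g ω)) 2 P :=
    (memLp_congr_ae hSae).1 (Lp.memLp S)
  refine (hasChaosExpansion_iff P _ _).2 ⟨hmem, ?_⟩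
  have : hmem.toLp _ = S := Lp.ext (hmem.coeFn_toLp.trans hSae.symm)
  rw [this]
  exact hS

theorem isWickPower_of_ae_eq_Q (g : L2R) (n : ℕ) {B : Omega → ℂ} (hB : B =ᵐ[P] Q P g) :
    IsWickPower P n B (fun ω => wickFormula n (∫ x, (g x) ^ 2) (B ω)) := by
  have h1 : HasChaosExpansion P (wickMonomial (hermiteCoord g) 1) B := by
    refine (hasChaosExpansion_wickFormula P g 1).congr ?_
    filter_upwards [hB] with ω e
    rw [wickFormula_one, e]
  refine ⟨⟨⟨_, isKondratiev_wickMonomial (summable_norm_sq_hermiteCoord g) 1⟩, h1⟩, fun Φ hΦ => ?_⟩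
  -- Uniqueness forces every expansion `Φ` of `B` to be the degree-one one, whose Wick powers are
  -- known.
  rw [wickPow_eq_wickMonomial (hΦ.unique P h1) n]
  refine (hasChaosExpansion_wickFormula P g n).congr ?_
  filter_upwards [hB] with ω e
  rw [e]

end Expansion

/-- For real `g` conjugation is trivial, so the bilinear square is the Hermitian one. -/
theorem integral_sq_eq_norm_sq {g : L2R} (hg : ∀ᵐ x : ℝ, (g x).im = 0) :
    ∫ x : ℝ, (g x) ^ 2 = (‖g‖ : ℂ) ^ 2 := by
  have h := inner_self_eq_norm_sq_to_K (𝕜 := ℂ) g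
  rw [L2.inner_def] at h
  refine Eq.trans (integral_congr_ae ?_) h
  filter_upwards [hg] with x hx
  rw [RCLike.inner_apply, Complex.conj_eq_iff_im.2 hx, sq]

end WhiteNoise

end

/-! ### The proposition for `T_m f` and for versions of `Q_{T_m I_t}`. -/

theorem proposition6p6 (P : MeasureTheory.Measure WhiteNoise.Omega) [WhiteNoise.IsWhiteNoise P]
    (m : ℝ → ℝ) (hm : Measurable m) (hm0 : ∀ u, 0 ≤ m u)
    (hmint : MeasureTheory.Integrable (fun u : ℝ => m u / (u ^ 2 + 1)))
    (n : ℕ) (hn : 1 ≤ n) :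
    (∀ f : (WhiteNoise.Tm m).domain,
      ((∀ᵐ x : ℝ, ((WhiteNoise.Tm m f : WhiteNoise.L2R) x).im = 0) →
        WhiteNoise.IsWickPower P n (WhiteNoise.Q P (WhiteNoise.Tm m f))
          (fun ω => WhiteNoise.wickFormula n ((‖WhiteNoise.Tm m f‖ : ℂ) ^ 2)
            (WhiteNoise.Q P (WhiteNoise.Tm m f) ω))) ∧
      WhiteNoise.IsWickPower P n (WhiteNoise.Q P (WhiteNoise.Tm m f))
        (fun ω => WhiteNoise.wickFormula n (∫ x : ℝ, ((WhiteNoise.Tm m f : WhiteNoise.L2R) x) ^ 2)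
          (WhiteNoise.Q P (WhiteNoise.Tm m f) ω))) ∧
    (∀ t : ℝ, ∃ ht : WhiteNoise.intervalL2 t ∈ (WhiteNoise.Tm m).domain,
      ∀ B : WhiteNoise.Omega → ℂ,
        B =ᵐ[P] WhiteNoise.Q P (WhiteNoise.Tm m ⟨WhiteNoise.intervalL2 t, ht⟩) →
        ((∀ᵐ u : ℝ, m (-u) = m u) →
          WhiteNoise.IsWickPower P n B
            (fun ω => WhiteNoise.wickFormula n
              ((‖WhiteNoise.Tm m ⟨WhiteNoise.intervalL2 t, ht⟩‖ : ℂ) ^ 2) (B ω))) ∧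
        WhiteNoise.IsWickPower P n B
          (fun ω => WhiteNoise.wickFormula n
            (∫ x : ℝ, ((WhiteNoise.Tm m ⟨WhiteNoise.intervalL2 t, ht⟩ : WhiteNoise.L2R) x) ^ 2)
            (B ω))) := by
  have hQ := fun (g : WhiteNoise.L2R) (B : WhiteNoise.Omega → ℂ) (hB : B =ᵐ[P] WhiteNoise.Q P g) =>
    WhiteNoise.isWickPower_of_ae_eq_Q P g n hB
  refine ⟨fun f => ⟨fun him => ?_, hQ _ _ EventuallyEq.rfl⟩, fun t =>
    ⟨WhiteNoise.intervalL2_mem_domain hm hm0 hmint t, fun B hB => ⟨fun heven => ?_, hQ _ _ hB⟩⟩⟩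
  · rw [← WhiteNoise.integral_sq_eq_norm_sq him]
    exact hQ _ _ EventuallyEq.rfl
  · rw [← WhiteNoise.integral_sq_eq_norm_sq (WhiteNoise.im_Tm_intervalL2_eq_zero _ heven)]
    exact hQ _ _ hB
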